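/- **Setting.** A $d$-dimensional state is a positive semidefinite $\rho\in\mathbb C^{d\times d}$ with $\operatorname{tr}\rho=1$. A *fixed $t$-copy tester* performs POVMs $\mathcal M_1,\dots,\mathcal M_n$, where $\mathcal M_i$ (with outcomes in an arbitrary measurable space) is applied to a fresh batch $\rho^{\otimes t_i}$, $1\le t_i\le t$, of the unknown state $\rho$, and then accepts or rejects according to the tuple of outcomes; it consumes $\sum_i t_i$ copies ($nt$ copies if all batches have size $t$). A *tester with non-adaptive $t$-copy measurements* draws a random seed before measuring anything, and the seed determines the whole fixed $t$-copy tester that is run (so the randomness may be shared among the measurements, but no choice of a measurement depends on earlier outcomes); it uses at most $N$ copies if the fixed tester consumes at most $N$ copies for every seed. It *$\epsilon$-certifies* a known state $\sigma$ (in trace norm) if, for every unknown state $\rho$, with probability at least $0.99$ it accepts when $\rho=\sigma$ and rejects when $\|\rho-\sigma\|_1\ge\epsilon$. The *copy complexity* of $\epsilon$-trace norm certification of $d$-dimensional states with non-adaptive $t$-copy measurements is the least $N$ such that every $d$-dimensional state $\sigma$ can be $\epsilon$-certified by such a tester using at most $N$ copies (and $\infty$ if there is none). **Theorem.** 1. There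 are absolute constants $c_0,c>0$ and $d^*\in\mathbb N$ such that for all integers $d>d^*$, $t\ge1$ and all $0<\epsilon\le c_0/t$, the copy complexity of $\epsilon$-trace norm certification of $d$-dimensional states with non-adaptive $t$-copy measurements is at least $$c\,\min\left\{\frac{d^{3/2}}{t\epsilon^2},\ \frac{1}{t^2\epsilon^3}\right\}.$$ 2. There are absolute constants $c_0,c>0$ and $d^*\in\mathbb N$ such that for all integers $d>d^*$, $t\ge1$ and all $0<\epsilon\le \dfrac{c_0}{d^{3/2}t}$, this copy complexity is at least $$c\,\max\left\{\frac{d^{3/2}}{t\epsilon^2},\ \frac{d}{\epsilon^2}\right\}.$$ -/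

import Mathlib

open MeasureTheory
open scoped ENNReal ComplexOrder

universe u v

/-- A quantum state (density operator) on the space with orthonormal basis `I`: a positive
semidefinite complex matrix of unit trace. -/
structure QState (I : Type) [Fintype I] where
  mat : Matrix I I ℂ
  posSemidef : mat.PosSemidef
  trace_eq_one : mat.trace = 1

/-- The trace norm (Schatten `1`-norm): the sum of the singular values of `A`, that is, of the
square roots of the eigenvalues of `Aᴴ * A`. -/
noncomputable def traceNorm {I : Type} [Fintype I] [DecidableEq I] (A : Matrix I I ℂ) : ℝ :=
  ∑ i, Real.sqrt ((Matrix.isHermitian_conjTranspose_mul_self A).eigenvalues i)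

/-- The matrix of `A ⊗ ⋯ ⊗ A` (`k` factors) in the product basis. -/
def tensorPow {I : Type} (A : Matrix I I ℂ) (k : ℕ) : Matrix (Fin k → I) (Fin k → I) ℂ :=
  Matrix.of fun x y => ∏ j, A (x j) (y j)

theorem exists_eq_conjTranspose_mul {I : Type} [Fintype I] {A : Matrix I I ℂ}
    (hA : A.PosSemidef) : ∃ B : Matrix I I ℂ, A = B.conjTranspose * B := by
  classical
  open scoped MatrixOrder in
  obtain ⟨B, hB⟩ := CStarAlgebra.nonneg_iff_eq_star_mul_self.mp hA.nonneg
  exact ⟨B, hB⟩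

theorem tensorPow_posSemidef {I : Type} [Fintype I] {A : Matrix I I ℂ} (hA : A.PosSemidef)
    (k : ℕ) : (tensorPow A k).PosSemidef := by
  classical
  obtain ⟨B, rfl⟩ := exists_eq_conjTranspose_mul hA
  have h : tensorPow (B.conjTranspose * B) k = (tensorPow B k).conjTranspose * tensorPow B k := by
    ext x y
    simp only [tensorPow, Matrix.of_apply, Matrix.mul_apply, Matrix.conjTranspose_apply,
      star_prod, ← Finset.prod_mul_distrib]
    rw [Finset.prod_univ_sum, Fintype.piFinset_univ]
  rw [h]
  exact Matrix.posSemidef_conjTranspose_mul_self _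

theorem tensorPow_trace {I : Type} [Fintype I] (A : Matrix I I ℂ) (k : ℕ) :
    (tensorPow A k).trace = A.trace ^ k := by
  classical
  simp only [tensorPow, Matrix.trace, Matrix.diag_apply, Matrix.of_apply]
  exact (Fintype.sum_pow (fun i => A i i) k).symm

/-- `k` independent copies `ρ ⊗ ⋯ ⊗ ρ` of a state. -/
def QState.copies {I : Type} [Fintype I] [DecidableEq I] (ρ : QState I) (k : ℕ) :
    QState (Fin k → I) where
  mat := tensorPow ρ.mat k
  posSemidef := tensorPow_posSemidef ρ.posSemidef k
  trace_eq_one := by rw [tensorPow_trace, ρ.trace_eq_one, one_pow]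

/-- A positive-operator valued measure on the space with orthonormal basis `I`, with outcomes in an
arbitrary measurable space `X` (finite, countable or continuous): a countably additive set function
with positive semidefinite values and total mass the identity. -/
structure POVM (I : Type) [Fintype I] [DecidableEq I] (X : Type*) [MeasurableSpace X] where
  effect : VectorMeasure X (Matrix I I ℂ)
  posSemidef : ∀ A, (effect A).PosSemidef
  effect_univ : effect Set.univ = 1

theorem trace_mul_re_nonneg {I : Type} [Fintype I] {A B : Matrix I I ℂ} (hA : A.PosSemidef)
    (hB : B.PosSemidef) : 0 ≤ (A * B).trace.re := by
  classical
  obtain ⟨C, rfl⟩ := exists_eq_conjTranspose_mul hB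
  rw [← Matrix.mul_assoc, Matrix.trace_mul_comm, ← Matrix.mul_assoc]
  have h := (hA.mul_mul_conjTranspose_same C).trace_nonneg
  exact (Complex.le_def.mp h).1

/-- The Born rule: the law of the outcome when the POVM `M` is applied to the state `ρ`, which
gives a measurable set `A` of outcomes the probability `tr (M(A) ρ)`. -/
noncomputable def POVM.law {I : Type} [Fintype I] [DecidableEq I] {X : Type*} [MeasurableSpace X]
    (M : POVM I X) (ρ : QState I) : Measure X :=
  Measure.ofMeasurable (fun A _ => ENNReal.ofReal ((M.effect A * ρ.mat).trace.re))
    (by simp)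
    (by
      intro f hf hd
      have hc : Continuous fun B : Matrix I I ℂ => (B * ρ.mat).trace.re := by fun_prop
      let g : Matrix I I ℂ →+ ℝ :=
        { toFun := fun B => (B * ρ.mat).trace.re
          map_zero' := by simp
          map_add' := fun B C => by simp [Matrix.add_mul, Matrix.trace_add] }
      have hs : HasSum (fun i => (M.effect (f i) * ρ.mat).trace.re)
          ((M.effect (⋃ i, f i) * ρ.mat).trace.re) := (M.effect.m_iUnion hf hd).map g hc
      rw [← hs.tsum_eq]
      exact ENNReal.ofReal_tsum_of_nonneg
        (fun i => trace_mul_re_nonneg (M.posSemidef _) ρ.posSemidef) hs.summable)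

theorem POVM.law_apply {I : Type} [Fintype I] [DecidableEq I] {X : Type*} [MeasurableSpace X]
    (M : POVM I X) (ρ : QState I) {A : Set X} (hA : MeasurableSet A) :
    M.law ρ A = ENNReal.ofReal ((M.effect A * ρ.mat).trace.re) :=
  Measure.ofMeasurable_apply A hA

instance POVM.law_isProbabilityMeasure {I : Type} [Fintype I] [DecidableEq I] {X : Type*}
    [MeasurableSpace X] (M : POVM I X) (ρ : QState I) : IsProbabilityMeasure (M.law ρ) :=
  ⟨by rw [M.law_apply ρ MeasurableSet.univ, M.effect_univ, one_mul, ρ.trace_eq_one]; simp⟩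

/-- A fixed schedule of `t`-copy measurements on copies of a `d`-dimensional state together with a
decision rule: `n` POVMs, the `i`-th one acting jointly on a fresh batch of `size i` copies,
`1 ≤ size i ≤ t`; the tester accepts iff the tuple of all outcomes lies in the measurable set
`accept`. -/
structure FixedTester (d t : ℕ) where
  n : ℕ
  size : Fin n → ℕ
  one_le_size : ∀ i, 1 ≤ size i
  size_le : ∀ i, size i ≤ t
  Outcome : Fin n → Type u
  measurableSpace : ∀ i, MeasurableSpace (Outcome i)
  povm : ∀ i, POVM (Fin (size i) → Fin d) (Outcome i)
  accept : Set (∀ i, Outcome i)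
  measurableSet_accept : MeasurableSet accept

attribute [instance] FixedTester.measurableSpace

/-- The total number of copies consumed. -/
def FixedTester.copies {d t : ℕ} (T : FixedTester d t) : ℕ := ∑ i, T.size i

/-- The probability of acceptance when the unknown state is `ρ`; the outcomes of the different
measurements are independent. -/
noncomputable def FixedTester.acceptProb {d t : ℕ} (T : FixedTester d t) (ρ : QState (Fin d)) : ℝ :=
  (Measure.pi fun i => (T.povm i).law (ρ.copies (T.size i))).real T.accept

/-- A tester with non-adaptive `t`-copy measurements and shared randomness: before any copy is
measured, a random seed `ω` is drawn, and it determines the whole schedule of measurements (hence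
they may be correlated) and the decision rule. No choice depends on measurement outcomes. -/
structure NonadaptiveTester (d t : ℕ) where
  Seed : Type v
  measurableSpace : MeasurableSpace Seed
  seedLaw : Measure Seed
  isProbabilityMeasure : IsProbabilityMeasure seedLaw
  tester : Seed → FixedTester.{u} d t
  measurable_acceptProb : ∀ ρ, Measurable fun ω => (tester ω).acceptProb ρ

attribute [instance] NonadaptiveTester.measurableSpace NonadaptiveTester.isProbabilityMeasure

/-- The overall probability of acceptance when the unknown state is `ρ`. -/
noncomputable def NonadaptiveTester.acceptProb {d t : ℕ} (T : NonadaptiveTester d t)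
    (ρ : QState (Fin d)) : ℝ :=
  ∫ ω, (T.tester ω).acceptProb ρ ∂T.seedLaw

/-- The tester never consumes more than `N` copies. -/
def NonadaptiveTester.UsesAtMost {d t : ℕ} (T : NonadaptiveTester d t) (N : ℕ) : Prop :=
  ∀ ω, (T.tester ω).copies ≤ N

/-- `ε`-trace norm certification of `σ`: with probability at least `0.99` the tester accepts if
`ρ = σ`, and rejects if `‖ρ - σ‖₁ ≥ ε`. -/
def NonadaptiveTester.Certifies {d t : ℕ} (T : NonadaptiveTester d t) (ε : ℝ)
    (σ : QState (Fin d)) : Prop :=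
  ∀ ρ : QState (Fin d),
    (ρ = σ → 0.99 ≤ T.acceptProb ρ) ∧
    (ε ≤ traceNorm (ρ.mat - σ.mat) → 0.99 ≤ 1 - T.acceptProb ρ)

/-- The copy complexity of `ε`-trace norm certification of `d`-dimensional states with non-adaptive
`t`-copy measurements: the least `N` such that every (known) hypothesis state `σ` can be certified
with at most `N` copies of the unknown state (`⊤` if there is no such `N`). -/
noncomputable def copyComplexity (d t : ℕ) (ε : ℝ) : ℕ∞ :=
  ⨅ (N : ℕ) (_ : ∀ σ : QState (Fin d), ∃ T : NonadaptiveTester.{u, v} d t,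
    T.UsesAtMost N ∧ T.Certifies ε σ), (N : ℕ∞)

/-!
The hypothesis state is maximally mixed on a subspace of dimension `D = 2m`, and the alternative is
`ρ_z = (1 + a H_z) / D` on that subspace, where `H_z` is the Hermitian matrix with a random
`m × m` sign matrix, divided by `√m`, in its off-diagonal blocks. The fourth moment of `H_z` is
bounded on average (`expect_rowCorrelation_le`), so its trace norm is of order `D` for most `z`
(`le_traceNorm_perturbation`): such `ρ_z` have to be rejected if `a` is a constant multiple of `ε`.
As the alternatives do not depend on the seed, some seed gives a fixed tester that tells the
hypothesis from the average of the `ρ_z`; its outcomes are independent, so the advantage is at most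
`½ 𝔼_{z,w} ∏ᵢ ∫ f_{z,i} f_{w,i}` with `f_{z,i}` the likelihood ratio of the `i`-th measurement
(`real_sub_expect_real_le`).

A measurement of `k` copies has a matrix-valued density whose values are states
(`POVM.exists_isDensity`). By positivity, the map from observables to their densities contracts the
normalised Hilbert–Schmidt norm to the `L²` norm (`IsDensity.integral_sq_le`). Expanding
`(1 + a H) ⊗ ⋯ ⊗ (1 + a H)` into the constant term, the part `a ∑ⱼ Hⱼ` and a remainder, which are
orthogonal to each other, shows that only the linear parts matter up to an error `O(k² a³)`
(`IsDensity.integral_tensorPow_mul_le`). The product over all measurements is then at most a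
constant times the exponential of a bilinear form `a² ∑ G_bc z_b w_c`, where `G` is the Gram matrix
of the linear parts. Such a Rademacher chaos has a bounded exponential moment as soon as
`a⁴ ‖G‖₂²` is small (`expect_exp_bilinear_le`).

Finally `‖G‖₂² ≤ ‖G‖ tr G`. For `N` copies in total the contraction gives `‖G‖ ≤ N / m²`, hence
`tr G ≤ N` by counting the `m²` coordinates; since the densities are states and a Hermitian matrix
is at most its Hilbert–Schmidt norm, also `tr G ≤ 2 t N / m` (`sum_sq_trace_siteSum_le`). The two
bounds on the trace produce the terms `d / ε²` and `d ^ (3 / 2) / (t ε²)`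
(`exists_not_certifies`). In the first part of the theorem, where `ε` may be large compared with
`1 / (t d ^ (3 / 2))`, the subspace is chosen smaller, of dimension about `(ε t) ^ (-2 / 3)`.
-/

open scoped BigOperators

/-! ### Rademacher averages -/

section Rademacher

variable {α : Type*} [DecidableEq α]

/-- The real number `±1` represented by a unit of `ℤ`. -/
def signVal (s : ℤˣ) : ℝ := ((s : ℤ) : ℝ)

theorem signVal_mul_self (s : ℤˣ) : signVal s * signVal s = 1 := by
  rcases Int.units_eq_one_or s with rfl | rfl <;> simp [signVal]

/-- The sign vector obtained from `z` by flipping its `a`-th coordinate. -/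
def flipSign (a : α) (z : α → ℤˣ) : α → ℤˣ := z * Pi.mulSingle a (-1)

theorem signVal_flipSign_same (a : α) (z : α → ℤˣ) :
    signVal (flipSign a z a) = -signVal (z a) := by
  simp [flipSign, signVal]

theorem flipSign_of_ne {a b : α} (h : b ≠ a) (z : α → ℤˣ) : flipSign a z b = z b := by
  simp [flipSign, Pi.mulSingle_eq_of_ne h]

theorem sum_flipSign_of_notMem {a : α} {s : Finset α} (ha : a ∉ s) (v : α → ℝ) (z : α → ℤˣ) :
    ∑ b ∈ s, v b * signVal (flipSign a z b) = ∑ b ∈ s, v b * signVal (z b) :=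
  Finset.sum_congr rfl fun b hb => by
    rw [flipSign_of_ne (ne_of_mem_of_not_mem hb ha)]

variable [Fintype α]

theorem expect_flipSign (a : α) (F : (α → ℤˣ) → ℝ) :
    (𝔼 z, F (flipSign a z)) = 𝔼 z, F z :=
  Fintype.expect_equiv (Equiv.mulRight (Pi.mulSingle a (-1 : ℤˣ))) _ _ fun _ => rfl

theorem expect_eq_half_flipSign (a : α) (F : (α → ℤˣ) → ℝ) :
    (𝔼 z, F z) = 𝔼 z, (F z + F (flipSign a z)) / 2 := by
  rw [← Finset.expect_div, Finset.expect_add_distrib, expect_flipSign]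
  ring

theorem expect_eq_zero_of_flipSign {a : α} {F : (α → ℤˣ) → ℝ}
    (h : ∀ z, F (flipSign a z) = -F z) : (𝔼 z, F z) = 0 := by
  rw [expect_eq_half_flipSign a]
  simp [h]

/-- Hoeffding's lemma for a Rademacher sum. -/
theorem expect_exp_sum_le (v : α → ℝ) (s : Finset α) :
    (𝔼 z : α → ℤˣ, Real.exp (∑ a ∈ s, v a * signVal (z a)))
      ≤ Real.exp ((∑ a ∈ s, v a ^ 2) / 2) := by
  induction s using Finset.induction_on with
  | empty => simp
  | insert a s ha ih =>
    rw [expect_eq_half_flipSign a]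
    have key : ∀ z : α → ℤˣ,
        (Real.exp (∑ b ∈ insert a s, v b * signVal (z b))
          + Real.exp (∑ b ∈ insert a s, v b * signVal (flipSign a z b))) / 2
        ≤ Real.exp (v a ^ 2 / 2) * Real.exp (∑ b ∈ s, v b * signVal (z b)) := by
      intro z
      rw [Finset.sum_insert ha, Finset.sum_insert ha, sum_flipSign_of_notMem ha,
        signVal_flipSign_same]
      have h := Real.cosh_le_exp_half_sq (v a * signVal (z a))
      rw [Real.cosh_eq, mul_pow, pow_two (signVal (z a)), signVal_mul_self, mul_one] at h
      calc _ = (Real.exp (v a * signVal (z a)) + Real.exp (-(v a * signVal (z a)))) / 2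
              * Real.exp (∑ b ∈ s, v b * signVal (z b)) := by
            rw [Real.exp_add, Real.exp_add, mul_neg]; ring
        _ ≤ _ := by gcongr
    calc _ ≤ 𝔼 z : α → ℤˣ, Real.exp (v a ^ 2 / 2)
            * Real.exp (∑ b ∈ s, v b * signVal (z b)) :=
          Finset.expect_le_expect fun z _ => key z
      _ = Real.exp (v a ^ 2 / 2) * 𝔼 z : α → ℤˣ, Real.exp (∑ b ∈ s, v b * signVal (z b)) :=
          (Finset.mul_expect ..).symm
      _ ≤ Real.exp (v a ^ 2 / 2) * Real.exp ((∑ b ∈ s, v b ^ 2) / 2) := by gcongr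
      _ = _ := by rw [← Real.exp_add, Finset.sum_insert ha]; ring_nf

/-- Square-exponential moment of a Rademacher sum. Averaging over one sign turns
`exp (τ (v a z a + S) ^ 2)` into at most `exp (τ (v a) ^ 2) * exp (τ (1 + 2 τ (v a) ^ 2) S ^ 2)`,
so the signs are removed one at a time while `τ` grows slightly. -/
theorem expect_exp_sq_sum_le (v : α → ℝ) (s : Finset α) (τ : ℝ) (hτ : 0 ≤ τ)
    (h : τ * ∑ a ∈ s, v a ^ 2 ≤ 1 / 4) :
    (𝔼 z : α → ℤˣ, Real.exp (τ * (∑ a ∈ s, v a * signVal (z a)) ^ 2))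
      ≤ Real.exp (2 * (τ * ∑ a ∈ s, v a ^ 2)) := by
  induction s using Finset.induction_on generalizing τ with
  | empty => simp
  | insert a s ha ih =>
    rw [Finset.sum_insert ha] at h ⊢
    set S : ℝ := ∑ b ∈ s, v b ^ 2 with hS
    have hS0 : 0 ≤ S := Finset.sum_nonneg fun b _ => sq_nonneg _
    set τ' : ℝ := τ * (1 + 2 * τ * v a ^ 2) with hτ'
    have hw : 0 ≤ τ * v a ^ 2 := by positivity
    have hτ'0 : 0 ≤ τ' := by positivity
    have hdec : τ' * S ≤ τ * (v a ^ 2 + S) - τ * v a ^ 2 / 2 := by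
      have : (τ * v a ^ 2) * (τ * S) ≤ (τ * v a ^ 2) * (1 / 4) :=
        mul_le_mul_of_nonneg_left (by nlinarith) hw
      rw [hτ']; nlinarith
    have key : ∀ z : α → ℤˣ,
        (Real.exp (τ * (∑ b ∈ insert a s, v b * signVal (z b)) ^ 2)
          + Real.exp (τ * (∑ b ∈ insert a s, v b * signVal (flipSign a z b)) ^ 2)) / 2
        ≤ Real.exp (τ * v a ^ 2) * Real.exp (τ' * (∑ b ∈ s, v b * signVal (z b)) ^ 2) := by
      intro z
      rw [Finset.sum_insert ha, Finset.sum_insert ha, sum_flipSign_of_notMem ha,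
        signVal_flipSign_same]
      set R : ℝ := ∑ b ∈ s, v b * signVal (z b)
      set ς : ℝ := signVal (z a) with hς
      have hς2 : ς * ς = 1 := signVal_mul_self _
      have hc := Real.cosh_le_exp_half_sq (2 * τ * (v a * ς) * R)
      rw [Real.cosh_eq] at hc
      have e1 : τ * (v a * ς + R) ^ 2 = τ * v a ^ 2 + τ * R ^ 2 + 2 * τ * (v a * ς) * R := by
        linear_combination (τ * v a ^ 2) * hς2
      have e2 : τ * (v a * -ς + R) ^ 2
          = τ * v a ^ 2 + τ * R ^ 2 + -(2 * τ * (v a * ς) * R) := by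
        linear_combination (τ * v a ^ 2) * hς2
      have e3 : τ * v a ^ 2 + τ * R ^ 2 + (2 * τ * (v a * ς) * R) ^ 2 / 2
          = τ * v a ^ 2 + τ' * R ^ 2 := by
        rw [hτ']; linear_combination (2 * τ ^ 2 * v a ^ 2 * R ^ 2) * hς2
      rw [e1, e2, Real.exp_add _ (2 * τ * (v a * ς) * R),
        Real.exp_add _ (-(2 * τ * (v a * ς) * R)), ← Real.exp_add (τ * v a ^ 2) (τ' * R ^ 2),
        ← e3, Real.exp_add _ ((2 * τ * (v a * ς) * R) ^ 2 / 2)]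
      have h0 := (Real.exp_pos (τ * v a ^ 2 + τ * R ^ 2)).le
      nlinarith [mul_le_mul_of_nonneg_left hc h0]
    rw [expect_eq_half_flipSign a]
    calc _ ≤ 𝔼 z : α → ℤˣ, Real.exp (τ * v a ^ 2)
            * Real.exp (τ' * (∑ b ∈ s, v b * signVal (z b)) ^ 2) :=
          Finset.expect_le_expect fun z _ => key z
      _ = Real.exp (τ * v a ^ 2)
            * 𝔼 z : α → ℤˣ, Real.exp (τ' * (∑ b ∈ s, v b * signVal (z b)) ^ 2) :=
          (Finset.mul_expect ..).symm
      _ ≤ Real.exp (τ * v a ^ 2) * Real.exp (2 * (τ' * S)) := by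
          gcongr
          exact ih τ' hτ'0 (by linarith)
      _ ≤ _ := by
          rw [← Real.exp_add]
          apply Real.exp_le_exp.mpr
          linarith

/-- A Rademacher chaos of order two has a bounded exponential moment as soon as its coefficient
matrix has small Frobenius norm. One sign vector is integrated out by Hoeffding's lemma; the
resulting sum of squares is a convex combination of multiples of squares of normalised
Rademacher sums, so Jensen's inequality reduces to `expect_exp_sq_sum_le`. -/
theorem expect_exp_bilinear_le (G : α → α → ℝ) (h : ∑ a, ∑ b, G a b ^ 2 ≤ 1 / 2) :
    (𝔼 z : α → ℤˣ, 𝔼 w : α → ℤˣ,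
        Real.exp (∑ a, ∑ b, G a b * signVal (z a) * signVal (w b)))
      ≤ Real.exp (∑ a, ∑ b, G a b ^ 2) := by
  classical
  set F : ℝ := ∑ a, ∑ b, G a b ^ 2 with hF
  set q : α → ℝ := fun b => ∑ a, G a b ^ 2 with hq
  have hq0 : ∀ b, 0 ≤ q b := fun b => Finset.sum_nonneg fun a _ => sq_nonneg _
  have hqF : ∑ b, q b = F := Finset.sum_comm
  have hF0 : 0 ≤ F := hqF ▸ Finset.sum_nonneg fun b _ => hq0 b
  set S : α → (α → ℤˣ) → ℝ := fun b z => ∑ a, G a b * signVal (z a) with hSdef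
  have step1 : ∀ z : α → ℤˣ,
      (𝔼 w : α → ℤˣ, Real.exp (∑ a, ∑ b, G a b * signVal (z a) * signVal (w b)))
        ≤ Real.exp ((∑ b, S b z ^ 2) / 2) := by
    intro z
    refine le_trans (le_of_eq ?_) (expect_exp_sum_le (fun b => S b z) Finset.univ)
    refine Finset.expect_congr rfl fun w _ => ?_
    rw [Finset.sum_comm]
    simp only [hSdef, Finset.sum_mul]
  refine (Finset.expect_le_expect fun z _ => step1 z).trans ?_
  rcases hF0.eq_or_lt with h0 | hpos
  · have hG : ∀ a b, G a b = 0 := by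
      intro a b
      have h1 := (Finset.sum_eq_zero_iff_of_nonneg fun b _ => hq0 b).mp (hqF.trans h0.symm) b
        (Finset.mem_univ b)
      have h2 := (Finset.sum_eq_zero_iff_of_nonneg fun a _ => sq_nonneg (G a b)).mp h1 a
        (Finset.mem_univ a)
      exact pow_eq_zero_iff two_ne_zero |>.mp h2
    simp [hSdef, hG, ← h0]
  · have step2 : ∀ z : α → ℤˣ, Real.exp ((∑ b, S b z ^ 2) / 2)
        ≤ ∑ b, (q b / F) * Real.exp ((F / (2 * q b)) * S b z ^ 2) := by
      intro z
      have hj := convexOn_exp.map_sum_le (t := Finset.univ) (w := fun b => q b / F)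
        (p := fun b => (F / (2 * q b)) * S b z ^ 2)
        (fun b _ => div_nonneg (hq0 b) hF0)
        (by rw [← Finset.sum_div, hqF, div_self hpos.ne'])
        (fun _ _ => Set.mem_univ _)
      simp only [smul_eq_mul] at hj
      refine le_trans (le_of_eq ?_) hj
      congr 1
      rw [Finset.sum_div]
      refine Finset.sum_congr rfl fun b _ => ?_
      rcases (hq0 b).eq_or_lt with hb | hb
      · have hG : ∀ a, G a b = 0 := fun a => pow_eq_zero_iff two_ne_zero |>.mp
          ((Finset.sum_eq_zero_iff_of_nonneg fun a _ => sq_nonneg (G a b)).mp hb.symm a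
            (Finset.mem_univ a))
        simp [hSdef, hG]
      · field_simp
    refine (Finset.expect_le_expect fun z _ => step2 z).trans ?_
    rw [Finset.expect_sum_comm]
    have step3 : ∀ b, (𝔼 z : α → ℤˣ, (q b / F) * Real.exp ((F / (2 * q b)) * S b z ^ 2))
        ≤ (q b / F) * Real.exp F := by
      intro b
      rw [← Finset.mul_expect]
      refine mul_le_mul_of_nonneg_left ?_ (div_nonneg (hq0 b) hF0)
      have hle : F / (2 * q b) * q b ≤ F / 2 := by
        rcases (hq0 b).eq_or_lt with hb | hb
        · rw [← hb]; simp; linarith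
        · apply le_of_eq; field_simp
      refine (expect_exp_sq_sum_le (fun a => G a b) Finset.univ (F / (2 * q b))
        (div_nonneg hF0 (by linarith [hq0 b])) (hle.trans (by linarith))).trans ?_
      exact Real.exp_le_exp.mpr (by change 2 * (F / (2 * q b) * q b) ≤ F; linarith)
    refine (Finset.sum_le_sum fun b _ => step3 b).trans ?_
    rw [← Finset.sum_mul, ← Finset.sum_div, hqF, div_self hpos.ne', one_mul]

/-- For a symmetric matrix `G` with `0 ≤ G ≤ K`, the squared Frobenius norm is at most
`K * tr G`. -/
theorem sum_sq_le_mul_trace {G : α → α → ℝ} {K : ℝ} (hsymm : ∀ a b, G a b = G b a)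
    (hnonneg : ∀ v : α → ℝ, 0 ≤ ∑ a, ∑ b, v a * v b * G a b)
    (hle : ∀ v : α → ℝ, ∑ a, ∑ b, v a * v b * G a b ≤ K * ∑ a, v a ^ 2) :
    ∑ a, ∑ b, G a b ^ 2 ≤ K * ∑ a, G a a := by
  rw [Finset.mul_sum]
  refine Finset.sum_le_sum fun c _ => ?_
  set w : ℝ := ∑ b, G c b ^ 2 with hw
  have hw0 : 0 ≤ w := Finset.sum_nonneg fun b _ => sq_nonneg _
  -- The form is nonnegative at `e_c - s G e_c` for every real `s`.
  have hquad : ∀ s : ℝ, 0 ≤ (K * w) * (s * s) + (-(2 * w)) * s + G c c := by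
    intro s
    have h1 := hnonneg fun a => (if a = c then 1 else 0) - s * G c a
    have h2 := hle fun a => G c a
    have e : ∑ a, ∑ b, ((if a = c then (1 : ℝ) else 0) - s * G c a)
          * ((if b = c then (1 : ℝ) else 0) - s * G c b) * G a b
        = G c c - 2 * s * w + s * s * ∑ a, ∑ b, G c a * G c b * G a b := by
      have e1 : ∀ a b, ((if a = c then (1 : ℝ) else 0) - s * G c a)
          * ((if b = c then (1 : ℝ) else 0) - s * G c b) * G a b
          = (if a = c then (if b = c then G a b else 0) else 0)
            - s * (if b = c then G c a * G a b else 0)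
            - s * (if a = c then G c b * G a b else 0)
            + s * s * (G c a * G c b * G a b) := by
        intro a b; split_ifs <;> ring
      simp only [e1, Finset.sum_add_distrib, Finset.sum_sub_distrib, ← Finset.mul_sum,
        Finset.sum_ite_eq', Finset.mem_univ, if_true]
      have e2 : ∑ a, ∑ b, (if a = c then (if b = c then G a b else 0) else 0) = G c c := by
        rw [Finset.sum_eq_single c] <;> simp +contextual
      have e3 : ∑ a, ∑ b, (if a = c then G c b * G a b else 0) = w := by
        rw [Finset.sum_eq_single c] <;> simp +contextual [hw, pow_two]
      have e4 : ∑ a, G c a * G a c = w :=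
        Finset.sum_congr rfl fun a _ => by rw [hsymm a c, pow_two]
      rw [e2, e3, e4]; ring
    rw [e] at h1
    nlinarith [mul_le_mul_of_nonneg_left h2 (mul_self_nonneg s)]
  have hd := discrim_le_zero hquad
  rw [discrim] at hd
  by_contra hcon
  push Not at hcon
  rcases hw0.eq_or_lt with h0 | hpos
  · have : 0 ≤ G c c := by simpa [← h0] using hquad 0
    have hK := hle fun a => if a = c then 1 else 0
    have hK' : G c c ≤ K := by
      have e2 : ∑ a, ∑ b, (if a = c then (1 : ℝ) else 0) * (if b = c then 1 else 0) * G a b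
          = G c c := by
        rw [Finset.sum_eq_single c] <;> simp +contextual
      rw [e2] at hK
      simpa using hK
    nlinarith
  · nlinarith

end Rademacher

/-! ### Tensor products of matrices -/

section Tensor

variable {I J K : Type} {k : ℕ}

/-- The matrix of `A 0 ⊗ ⋯ ⊗ A (k - 1)` in the product bases. -/
def tensorFam (A : Fin k → Matrix I J ℂ) : Matrix (Fin k → I) (Fin k → J) ℂ :=
  Matrix.of fun x y => ∏ j, A j (x j) (y j)

theorem tensorPow_eq_tensorFam (A : Matrix I I ℂ) (k : ℕ) :
    tensorPow A k = tensorFam fun _ : Fin k => A := rfl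

theorem tensorFam_mul [Fintype J] (A : Fin k → Matrix I J ℂ)
    (B : Fin k → Matrix J K ℂ) : tensorFam A * tensorFam B = tensorFam fun j => A j * B j := by
  classical
  ext x y
  simp only [tensorFam, Matrix.of_apply, Matrix.mul_apply, ← Finset.prod_mul_distrib]
  rw [Finset.prod_univ_sum, Fintype.piFinset_univ]

theorem tensorFam_conjTranspose (A : Fin k → Matrix I J ℂ) :
    (tensorFam A).conjTranspose = tensorFam fun j => (A j).conjTranspose := by
  ext x y
  simp [tensorFam]

theorem tensorFam_one [DecidableEq I] :
    tensorFam (fun _ : Fin k => (1 : Matrix I I ℂ)) = 1 := by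
  ext x y
  simp only [tensorFam, Matrix.of_apply, Matrix.one_apply, funext_iff]
  rw [Fintype.prod_boole (M₀ := ℂ) (p := fun j => x j = y j)]
  congr

theorem trace_tensorFam [Fintype I] (A : Fin k → Matrix I I ℂ) :
    (tensorFam A).trace = ∏ j, (A j).trace := by
  classical
  simp only [tensorFam, Matrix.trace, Matrix.diag_apply, Matrix.of_apply]
  rw [Finset.prod_univ_sum, Fintype.piFinset_univ]

theorem tensorFam_posSemidef [Fintype I] {A : Fin k → Matrix I I ℂ}
    (hA : ∀ j, (A j).PosSemidef) : (tensorFam A).PosSemidef := by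
  choose B hB using fun j => exists_eq_conjTranspose_mul (hA j)
  have h : tensorFam A = (tensorFam B).conjTranspose * tensorFam B := by
    rw [tensorFam_conjTranspose, tensorFam_mul]
    exact congrArg tensorFam (funext hB)
  rw [h]
  exact Matrix.posSemidef_conjTranspose_mul_self _

theorem tensorPow_smul (c : ℂ) (A : Matrix I I ℂ) (k : ℕ) :
    tensorPow (c • A) k = c ^ k • tensorPow A k := by
  ext x y
  simp [tensorPow, Finset.prod_mul_distrib]

theorem card_ne_zero_complex [Fintype I] [Nonempty I] : (Fintype.card I : ℂ) ≠ 0 :=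
  Nat.cast_ne_zero.mpr Fintype.card_ne_zero

section Site

variable [DecidableEq I]

/-- The operator `X` acting on the `j`-th of `k` tensor factors. -/
def siteOp (j : Fin k) (X : Matrix I I ℂ) : Matrix (Fin k → I) (Fin k → I) ℂ :=
  tensorFam (Function.update (fun _ => 1) j X)

theorem siteOp_apply (j : Fin k) (X : Matrix I I ℂ) (x y : Fin k → I) :
    siteOp j X x y
      = X (x j) (y j) * ∏ l ∈ Finset.univ.erase j, (1 : Matrix I I ℂ) (x l) (y l) := by
  simp only [siteOp, tensorFam, Matrix.of_apply]
  rw [← Finset.mul_prod_erase _ _ (Finset.mem_univ j), Function.update_self]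
  congr 1
  refine Finset.prod_congr rfl fun l hl => ?_
  rw [Function.update_of_ne (Finset.ne_of_mem_erase hl)]

theorem siteOp_one (j : Fin k) : siteOp j (1 : Matrix I I ℂ) = 1 := by
  rw [siteOp, ← tensorFam_one]
  congr 1
  exact Function.update_eq_self j _

theorem siteOp_sum {α : Type*} (s : Finset α) (u : α → ℂ) (B : α → Matrix I I ℂ) (j : Fin k) :
    siteOp j (∑ a ∈ s, u a • B a) = ∑ a ∈ s, u a • siteOp j (B a) := by
  ext x y
  simp only [siteOp_apply, Matrix.sum_apply, Matrix.smul_apply, smul_eq_mul, Finset.sum_mul,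
    mul_assoc]

theorem siteOp_sub (j : Fin k) (X Y : Matrix I I ℂ) :
    siteOp j (X - Y) = siteOp j X - siteOp j Y := by
  ext x y
  simp only [siteOp_apply, Matrix.sub_apply, sub_mul]

theorem siteOp_smul (j : Fin k) (c : ℂ) (X : Matrix I I ℂ) :
    siteOp j (c • X) = c • siteOp j X := by
  ext x y
  simp only [siteOp_apply, Matrix.smul_apply, smul_eq_mul, mul_assoc]

theorem siteOp_isHermitian {X : Matrix I I ℂ} (hX : X.IsHermitian) (j : Fin k) :
    (siteOp j X).IsHermitian := by
  rw [Matrix.IsHermitian, siteOp, tensorFam_conjTranspose]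
  congr 1
  funext l
  rcases eq_or_ne l j with rfl | h
  · simpa using hX.eq
  · simp [Function.update_of_ne h]

variable [Fintype I]

theorem siteOp_posSemidef {X : Matrix I I ℂ} (hX : X.PosSemidef) (j : Fin k) :
    (siteOp j X).PosSemidef := by
  refine tensorFam_posSemidef fun l => ?_
  rcases eq_or_ne l j with rfl | h
  · simpa using hX
  · simpa [Function.update_of_ne h] using Matrix.PosSemidef.one

theorem prod_update_const {q : ℂ} (hq : q ≠ 0) (p : ℂ) (j : Fin k) :
    ∏ l, Function.update (fun _ => q) j p l = q ^ k * (p / q) := by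
  rw [Finset.prod_update_of_mem (Finset.mem_univ j), Finset.prod_const,
    Finset.card_sdiff_of_subset (by simp)]
  obtain ⟨n, rfl⟩ : ∃ n, k = n + 1 := ⟨k - 1, by have := j.pos; omega⟩
  simp only [Finset.card_univ, Fintype.card_fin, Finset.card_singleton, Nat.add_sub_cancel,
    pow_succ]
  field_simp

theorem trace_siteOp_mul_siteOp_of_ne {X : Matrix I I ℂ} (hX : X.trace = 0) (Y : Matrix I I ℂ)
    {i j : Fin k} (h : i ≠ j) : (siteOp i X * siteOp j Y).trace = 0 := by
  rw [siteOp, siteOp, tensorFam_mul, trace_tensorFam]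
  refine Finset.prod_eq_zero (Finset.mem_univ i) ?_
  simp [Function.update_of_ne h, hX]

variable [Nonempty I]

theorem trace_siteOp (X : Matrix I I ℂ) (j : Fin k) :
    (siteOp j X).trace = (Fintype.card I : ℂ) ^ k * (X.trace / Fintype.card I) := by
  rw [siteOp, trace_tensorFam, ← prod_update_const card_ne_zero_complex _ j]
  refine Finset.prod_congr rfl fun l _ => ?_
  rcases eq_or_ne l j with rfl | h
  · simp
  · simp [Function.update_of_ne h]

theorem trace_siteOp_mul_siteOp_same (X Y : Matrix I I ℂ) (j : Fin k) :
    (siteOp j X * siteOp j Y).trace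
      = (Fintype.card I : ℂ) ^ k * ((X * Y).trace / Fintype.card I) := by
  rw [← trace_siteOp _ j, siteOp, siteOp, siteOp, tensorFam_mul]
  congr 2
  funext l
  rcases eq_or_ne l j with rfl | h
  · simp
  · simp [Function.update_of_ne h]

theorem trace_tensorPow_mul_siteOp {A : Matrix I I ℂ} (hA : A.trace = Fintype.card I)
    (X : Matrix I I ℂ) (j : Fin k) :
    (tensorPow A k * siteOp j X).trace
      = (Fintype.card I : ℂ) ^ k * ((A * X).trace / Fintype.card I) := by
  rw [tensorPow_eq_tensorFam, siteOp, tensorFam_mul, trace_tensorFam,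
    ← prod_update_const card_ne_zero_complex _ j]
  refine Finset.prod_congr rfl fun l _ => ?_
  rcases eq_or_ne l j with rfl | h
  · simp
  · simp [Function.update_of_ne h, hA]

end Site

section SiteSum

variable [DecidableEq I]

/-- The sum over the `k` tensor factors of the operator `X` acting on one factor: the part of
`(1 + X) ⊗ ⋯ ⊗ (1 + X)` that is linear in `X`. -/
def siteSum (k : ℕ) (X : Matrix I I ℂ) : Matrix (Fin k → I) (Fin k → I) ℂ :=
  ∑ j, siteOp j X

/-- The part of `(1 + X) ⊗ ⋯ ⊗ (1 + X)` of degree at least two in `X`. -/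
def tensorRem (k : ℕ) (X : Matrix I I ℂ) : Matrix (Fin k → I) (Fin k → I) ℂ :=
  tensorPow (1 + X) k - 1 - siteSum k X

theorem siteSum_sum {α : Type*} (s : Finset α) (u : α → ℂ) (B : α → Matrix I I ℂ) :
    siteSum k (∑ a ∈ s, u a • B a) = ∑ a ∈ s, u a • siteSum k (B a) := by
  simp only [siteSum, siteOp_sum, Finset.smul_sum]
  exact Finset.sum_comm

theorem siteSum_smul (c : ℂ) (X : Matrix I I ℂ) : siteSum k (c • X) = c • siteSum k X := by
  simp only [siteSum, siteOp_smul, Finset.smul_sum]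

theorem siteSum_isHermitian {X : Matrix I I ℂ} (hX : X.IsHermitian) :
    (siteSum k X).IsHermitian := by
  rw [Matrix.IsHermitian, siteSum, Matrix.conjTranspose_sum]
  exact Finset.sum_congr rfl fun j _ => siteOp_isHermitian hX j

theorem tensorRem_isHermitian {X : Matrix I I ℂ} (hX : X.IsHermitian) :
    (tensorRem k X).IsHermitian := by
  refine (Matrix.IsHermitian.sub ?_ Matrix.isHermitian_one).sub (siteSum_isHermitian hX)
  rw [Matrix.IsHermitian, tensorPow_eq_tensorFam, tensorFam_conjTranspose]
  simp [hX.eq]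

variable [Fintype I]

/-- An upper bound `s` for an observable of one copy gives the upper bound `k s` for its sum over
`k` copies. -/
theorem siteSum_le {X : Matrix I I ℂ} {s : ℝ} (h : ((s : ℂ) • 1 - X).PosSemidef) :
    (((k * s : ℝ) : ℂ) • 1 - siteSum k X).PosSemidef := by
  have e : ((k * s : ℝ) : ℂ) • (1 : Matrix (Fin k → I) (Fin k → I) ℂ) - siteSum k X
      = ∑ j : Fin k, siteOp j ((s : ℂ) • 1 - X) := by
    simp only [siteOp_sub, siteOp_smul, siteOp_one, Finset.sum_sub_distrib, siteSum]
    simp [mul_smul, Nat.cast_smul_eq_nsmul]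
  rw [e]
  exact Matrix.posSemidef_sum _ fun j _ => siteOp_posSemidef h j

variable [Nonempty I]

theorem trace_siteSum {X : Matrix I I ℂ} (hX : X.trace = 0) : (siteSum k X).trace = 0 := by
  simp [siteSum, Matrix.trace_sum, trace_siteOp, hX]

theorem trace_siteSum_mul_siteSum {X : Matrix I I ℂ} (hX : X.trace = 0) (Y : Matrix I I ℂ) :
    (siteSum k X * siteSum k Y).trace
      = (Fintype.card I : ℂ) ^ k * (k * ((X * Y).trace / Fintype.card I)) := by
  simp only [siteSum, Finset.sum_mul, Finset.mul_sum, Matrix.trace_sum]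
  have h : ∀ i j : Fin k, (siteOp i X * siteOp j Y).trace
      = if i = j then (Fintype.card I : ℂ) ^ k * ((X * Y).trace / Fintype.card I) else 0 := by
    intro i j
    split_ifs with hij
    · rw [hij, trace_siteOp_mul_siteOp_same]
    · exact trace_siteOp_mul_siteOp_of_ne hX Y hij
  simp only [h]
  simp
  ring

/-- The terms of degree zero, one and at least two of `(1 + X) ⊗ ⋯ ⊗ (1 + X)` are orthogonal when
`X` is traceless, so the norm of the last one is found by subtraction. -/
theorem trace_tensorRem_sq {X : Matrix I I ℂ} (hX : X.trace = 0) :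
    (tensorRem k X * tensorRem k X).trace
      = (Fintype.card I : ℂ) ^ k * ((1 + (X * X).trace / Fintype.card I) ^ k - 1
          - k * ((X * X).trace / Fintype.card I)) := by
  have hD := card_ne_zero_complex (I := I)
  have hA : (1 + X : Matrix I I ℂ).trace = Fintype.card I := by
    simp [Matrix.trace_add, hX]
  have h1 : (tensorPow (1 + X) k * tensorPow (1 + X) k).trace
      = (Fintype.card I : ℂ) ^ k * (1 + (X * X).trace / Fintype.card I) ^ k := by
    rw [tensorPow_eq_tensorFam, tensorFam_mul, trace_tensorFam, Finset.prod_const, ← mul_pow]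
    simp only [Finset.card_univ, Fintype.card_fin]
    congr 1
    simp only [add_mul, mul_add, Matrix.trace_add, hX, one_mul, mul_one, Matrix.trace_one]
    field_simp
    ring
  have h2 : (tensorPow (1 + X) k).trace = (Fintype.card I : ℂ) ^ k := by
    rw [tensorPow_trace, hA]
  have h3 : (tensorPow (1 + X) k * siteSum k X).trace
      = (Fintype.card I : ℂ) ^ k * (k * ((X * X).trace / Fintype.card I)) := by
    simp only [siteSum, Finset.mul_sum, Matrix.trace_sum, trace_tensorPow_mul_siteOp hA]
    simp [add_mul, Matrix.trace_add, hX]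
    ring
  have h4 := trace_siteSum_mul_siteSum (k := k) hX X
  have h5 := trace_siteSum (k := k) hX
  have e : tensorRem k X * tensorRem k X
      = tensorPow (1 + X) k * tensorPow (1 + X) k - tensorPow (1 + X) k - tensorPow (1 + X) k
        - tensorPow (1 + X) k * siteSum k X - siteSum k X * tensorPow (1 + X) k
        + 1 + siteSum k X + siteSum k X + siteSum k X * siteSum k X := by
    rw [tensorRem]; noncomm_ring
  rw [e]
  simp only [Matrix.trace_add, Matrix.trace_sub, h1, h2, h3, h4, h5,
    Matrix.trace_mul_comm (siteSum k X) (tensorPow (1 + X) k), Matrix.trace_one]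
  simp
  ring

end SiteSum

end Tensor

/-! ### Positivity and the trace norm -/

section TraceNorm

variable {I : Type} [Fintype I] [DecidableEq I]

/-- The square of the mean of the observable `B` in the state `m` is at most the mean of its
square. -/
theorem trace_mul_sq_le {m B : Matrix I I ℂ} (hm : m.PosSemidef) (htr : m.trace = 1)
    (hB : B.IsHermitian) : (m * B).trace.re ^ 2 ≤ (m * (B * B)).trace.re := by
  set c : ℝ := (m * B).trace.re with hc
  have hH : (B - (c : ℂ) • (1 : Matrix I I ℂ)).IsHermitian := by
    refine hB.sub ?_
    rw [Matrix.IsHermitian, Matrix.conjTranspose_smul]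
    simp
  have hpsd := Matrix.posSemidef_conjTranspose_mul_self (B - (c : ℂ) • (1 : Matrix I I ℂ))
  rw [hH.eq] at hpsd
  have h := trace_mul_re_nonneg hm hpsd
  have e : m * ((B - (c : ℂ) • (1 : Matrix I I ℂ)) * (B - (c : ℂ) • (1 : Matrix I I ℂ)))
      = m * (B * B) - (c : ℂ) • (m * B) - (c : ℂ) • (m * B) + ((c : ℂ) * c) • m := by
    simp only [sub_mul, mul_sub, Matrix.smul_mul, Matrix.mul_smul, one_mul, mul_one, smul_smul]
    abel
  rw [e] at h
  simp only [Matrix.trace_add, Matrix.trace_sub, Matrix.trace_smul, htr, smul_eq_mul, mul_one,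
    Complex.add_re, Complex.sub_re, Complex.mul_re, Complex.ofReal_re,
    Complex.ofReal_im, ← hc] at h
  nlinarith

theorem trace_re_eq_sum_eigenvalues {A : Matrix I I ℂ} (hA : A.IsHermitian) :
    A.trace.re = ∑ i, hA.eigenvalues i := by
  rw [hA.trace_eq_sum_eigenvalues]
  simp

theorem trace_mul_self_re_eq_sum_eigenvalues {A : Matrix I I ℂ} (hA : A.IsHermitian) :
    (A * A).trace.re = ∑ i, hA.eigenvalues i ^ 2 := by
  have h := hA.spectral_theorem
  set U := hA.eigenvectorUnitary
  set Λ : Matrix I I ℂ := Matrix.diagonal (RCLike.ofReal ∘ hA.eigenvalues)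
  have h2 : A * A = Unitary.conjStarAlgAut ℂ _ U (Λ * Λ) := by
    rw [map_mul, ← h]
  rw [h2, Unitary.conjStarAlgAut_apply, Matrix.trace_mul_comm, ← Matrix.mul_assoc]
  simp [Λ, Matrix.diagonal_mul_diagonal, Matrix.trace_diagonal, pow_two]

/-- A Hermitian matrix is at most its Hilbert–Schmidt norm times the identity. -/
theorem smul_one_sub_posSemidef {X : Matrix I I ℂ} (hX : X.IsHermitian) {s : ℝ} (hs : 0 ≤ s)
    (h : (X * X).trace.re ≤ s ^ 2) : ((s : ℂ) • 1 - X).PosSemidef := by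
  have hle : ∀ i, hX.eigenvalues i ≤ s := by
    intro i
    refine le_of_abs_le (abs_le_of_sq_le_sq ?_ hs)
    rw [trace_mul_self_re_eq_sum_eigenvalues hX] at h
    exact (Finset.single_le_sum (f := fun i => hX.eigenvalues i ^ 2)
      (fun i _ => sq_nonneg _) (Finset.mem_univ i)).trans h
  have hsp := hX.spectral_theorem
  set U := hX.eigenvectorUnitary
  have e : (s : ℂ) • 1 - X = (U : Matrix I I ℂ)
      * Matrix.diagonal (fun i => ((s - hX.eigenvalues i : ℝ) : ℂ))
      * (U : Matrix I I ℂ).conjTranspose := by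
    have e1 : Matrix.diagonal (fun i => ((s - hX.eigenvalues i : ℝ) : ℂ))
        = (s : ℂ) • 1 - Matrix.diagonal (RCLike.ofReal ∘ hX.eigenvalues) := by
      ext i j
      by_cases hij : i = j
      · subst hij; simp
      · simp [hij]
    rw [e1]
    conv_lhs => rw [hsp]
    rw [Unitary.conjStarAlgAut_apply, mul_sub, sub_mul]
    congr 1
    have hU : (U : Matrix I I ℂ) * (U : Matrix I I ℂ).conjTranspose = 1 :=
      Unitary.coe_mul_star_self U
    rw [Matrix.mul_smul, mul_one, Matrix.smul_mul, hU]
  rw [e]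
  refine Matrix.PosSemidef.mul_mul_conjTranspose_same ?_ _
  refine Matrix.PosSemidef.diagonal fun i => ?_
  rw [Pi.zero_apply, Complex.zero_le_real]
  exact sub_nonneg.mpr (hle i)

/-- The trace norm is bounded below by the second and fourth moments of the singular values `s`,
because `s ≥ (3 r s ^ 2 - r ^ 3 s ^ 4) / 2` for all `r, s ≥ 0`. -/
theorem le_traceNorm (A : Matrix I I ℂ) {r : ℝ} (hr : 0 < r) :
    (3 * r * (A.conjTranspose * A).trace.re
      - r ^ 3 * (A.conjTranspose * A * (A.conjTranspose * A)).trace.re) / 2 ≤ traceNorm A := by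
  have hH := Matrix.isHermitian_conjTranspose_mul_self A
  rw [trace_mul_self_re_eq_sum_eigenvalues hH, trace_re_eq_sum_eigenvalues hH, Finset.mul_sum,
    Finset.mul_sum, ← Finset.sum_sub_distrib, Finset.sum_div]
  refine Finset.sum_le_sum fun i _ => ?_
  set x := hH.eigenvalues i
  have hx : 0 ≤ x := (Matrix.posSemidef_conjTranspose_mul_self A).eigenvalues_nonneg i
  obtain ⟨s, hs0, hs⟩ : ∃ s : ℝ, 0 ≤ s ∧ s ^ 2 = x := ⟨Real.sqrt x, Real.sqrt_nonneg x,
    Real.sq_sqrt hx⟩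
  rw [← hs, Real.sqrt_sq hs0]
  have hrs : 0 ≤ r * s := by positivity
  have h : 0 ≤ (r * s) * (r * s - 1) ^ 2 * (r * s + 2) / 2 := by positivity
  have h' : 0 ≤ r * (s - (3 * r * s ^ 2 - r ^ 3 * (s ^ 2) ^ 2) / 2) := by
    have : r * (s - (3 * r * s ^ 2 - r ^ 3 * (s ^ 2) ^ 2) / 2)
      = (r * s) * (r * s - 1) ^ 2 * (r * s + 2) / 2 := by ring
    rwa [this]
  have := nonneg_of_mul_nonneg_right h' hr
  linarith

end TraceNorm

/-! ### Matrix-valued densities of measurements -/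

section Density

variable {I : Type} [Fintype I]

theorem QState.ext_mat {ρ τ : QState I} (h : ρ.mat = τ.mat) : ρ = τ := by
  cases ρ; cases τ; simpa using h

theorem integral_trace_mul_re {X : Type*} [MeasurableSpace X] {μ : Measure X} {m : X → Matrix I I ℂ}
    (hm : ∀ a b, Integrable (fun x => m x a b) μ) (B : Matrix I I ℂ) :
    ∫ x, (m x * B).trace.re ∂μ = ((Matrix.of fun a b => ∫ x, m x a b ∂μ) * B).trace.re := by
  have h : ∀ a b, Integrable (fun x => m x a b * B b a) μ := fun a b => (hm a b).mul_const _
  have h2 : ∫ x, (m x * B).trace.re ∂μ = (∫ x, (m x * B).trace ∂μ).re := by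
    refine integral_re (𝕜 := ℂ) (f := fun x => (m x * B).trace) ?_
    simp only [Matrix.trace, Matrix.diag_apply, Matrix.mul_apply]
    exact integrable_finsetSum _ fun a _ => integrable_finsetSum _ fun b _ => h a b
  rw [h2]
  congr 1
  simp only [Matrix.trace, Matrix.diag_apply, Matrix.mul_apply, Matrix.of_apply]
  rw [integral_finsetSum _ fun a _ => integrable_finsetSum _ fun b _ => h a b]
  refine Finset.sum_congr rfl fun a _ => ?_
  rw [integral_finsetSum _ fun b _ => h a b]
  exact Finset.sum_congr rfl fun b _ => integral_mul_const _ _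

/-- Positivity of a quadratic form need only be tested on a dense set of vectors. -/
theorem posSemidef_of_denseSeq {A : Matrix I I ℂ} (hA : A.IsHermitian)
    (h : ∀ n, 0 ≤ (A * Matrix.vecMulVec (TopologicalSpace.denseSeq (I → ℂ) n)
      (star (TopologicalSpace.denseSeq (I → ℂ) n))).trace.re) : A.PosSemidef := by
  have hcl : ∀ v : I → ℂ, 0 ≤ (A * Matrix.vecMulVec v (star v)).trace.re := by
    intro v
    have hc : IsClosed {v : I → ℂ | 0 ≤ (A * Matrix.vecMulVec v (star v)).trace.re} := by
      refine isClosed_le continuous_const ?_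
      refine Complex.continuous_re.comp (Continuous.matrix_trace ?_)
      refine continuous_const.matrix_mul ?_
      exact continuous_id.matrix_vecMulVec continuous_star
    exact (TopologicalSpace.denseRange_denseSeq (I → ℂ)).induction_on
      (p := fun v => 0 ≤ (A * Matrix.vecMulVec v (star v)).trace.re) v hc h
  refine Matrix.PosSemidef.of_dotProduct_mulVec_nonneg hA fun v => ?_
  have h1 := hcl v
  rw [Matrix.mul_vecMulVec, Matrix.trace_vecMulVec, dotProduct_comm] at h1
  refine Complex.le_def.mpr ⟨h1, ?_⟩
  exact (hA.im_star_dotProduct_mulVec_self v).symm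

variable [DecidableEq I]

/-- The maximally mixed state. -/
noncomputable def QState.maxMixed (I : Type) [Fintype I] [DecidableEq I] [Nonempty I] :
    QState I where
  mat := ((Fintype.card I : ℝ)⁻¹ : ℂ) • 1
  posSemidef := Matrix.PosSemidef.one.smul (by
    rw [← Complex.ofReal_inv, Complex.zero_le_real]; positivity)
  trace_eq_one := by
    rw [Matrix.trace_smul, Matrix.trace_one, smul_eq_mul]
    simp

theorem QState.copies_maxMixed [Nonempty I] (k : ℕ) :
    (QState.maxMixed I).copies k = QState.maxMixed (Fin k → I) := by
  refine QState.ext_mat ?_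
  change tensorPow _ k = _
  rw [QState.maxMixed, tensorPow_smul, tensorPow_eq_tensorFam, tensorFam_one, QState.maxMixed]
  simp

variable [Nonempty I] {X : Type*} [MeasurableSpace X]

theorem POVM.law_maxMixed_real (M : POVM I X) {A : Set X} (hA : MeasurableSet A) :
    (M.law (QState.maxMixed I)).real A = (M.effect A).trace.re / Fintype.card I := by
  rw [Measure.real, M.law_apply _ hA, ENNReal.toReal_ofReal
    (trace_mul_re_nonneg (M.posSemidef _) (QState.posSemidef _))]
  simp only [QState.maxMixed, Matrix.mul_smul, mul_one, Matrix.trace_smul, smul_eq_mul]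
  rw [← Complex.ofReal_inv, Complex.re_ofReal_mul]
  ring

/-- `m` is a Radon–Nikodym density of the measurement `M` with respect to the law of its outcome
on the maximally mixed state, normalised to have trace one. -/
structure IsDensity (M : POVM I X) (m : X → Matrix I I ℂ) : Prop where
  measurable : ∀ a b, Measurable fun x => m x a b
  integrable : ∀ a b, Integrable (fun x => m x a b) (M.law (QState.maxMixed I))
  posSemidef : ∀ᵐ x ∂M.law (QState.maxMixed I), (m x).PosSemidef
  trace_eq_one : ∀ᵐ x ∂M.law (QState.maxMixed I), (m x).trace = 1
  setIntegral : ∀ (B : Matrix I I ℂ) (A : Set X), MeasurableSet A →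
    ∫ x in A, (m x * B).trace.re ∂M.law (QState.maxMixed I)
      = (M.effect A * B).trace.re / Fintype.card I

/-- An additive, continuous, real-valued function of the effects of a measurement is the integral
of a density with respect to the law on the maximally mixed state, as an effect of trace zero
vanishes. -/
theorem POVM.exists_density_of_addMonoidHom (M : POVM I X) (φ : Matrix I I ℂ →+ ℝ)
    (hφ : Continuous φ) : ∃ f : X → ℝ, Measurable f ∧ Integrable f (M.law (QState.maxMixed I)) ∧
      ∀ A, MeasurableSet A → ∫ x in A, f x ∂M.law (QState.maxMixed I) = φ (M.effect A) := by
  set μ := M.law (QState.maxMixed I)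
  set s : SignedMeasure X := M.effect.mapRange φ hφ
  have hac : s ≪ᵥ μ.toENNRealVectorMeasure := by
    refine VectorMeasure.AbsolutelyContinuous.mk fun A hA h0 => ?_
    rw [Measure.toENNRealVectorMeasure_apply_measurable hA] at h0
    have h1 : μ.real A = 0 := by rw [Measure.real, h0]; rfl
    rw [M.law_maxMixed_real hA, div_eq_zero_iff] at h1
    have hre : (M.effect A).trace.re = 0 :=
      h1.resolve_right (Nat.cast_ne_zero.mpr Fintype.card_ne_zero)
    have htr : (M.effect A).trace = 0 := by
      refine Complex.ext hre ?_
      exact ((Complex.le_def.mp (M.posSemidef A).trace_nonneg).2).symm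
    rw [VectorMeasure.mapRange_apply, (M.posSemidef A).trace_eq_zero_iff.mp htr, map_zero]
  refine ⟨s.rnDeriv μ, SignedMeasure.measurable_rnDeriv s μ,
    SignedMeasure.integrable_rnDeriv s μ, fun A hA => ?_⟩
  rw [← withDensityᵥ_apply (SignedMeasure.integrable_rnDeriv s μ) hA,
    SignedMeasure.withDensityᵥ_rnDeriv_eq s μ hac, VectorMeasure.mapRange_apply]

/-- Every measurement on a finite-dimensional system has a matrix-valued density. -/
theorem POVM.exists_isDensity (M : POVM I X) : ∃ m, IsDensity M m := by
  set μ := M.law (QState.maxMixed I) with hμ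
  have hD : (Fintype.card I : ℝ) ≠ 0 := Nat.cast_ne_zero.mpr Fintype.card_ne_zero
  let reHom : I → I → Matrix I I ℂ →+ ℝ := fun a b =>
    { toFun := fun A => (A a b).re / Fintype.card I
      map_zero' := by simp
      map_add' := fun A B => by simp [add_div] }
  let imHom : I → I → Matrix I I ℂ →+ ℝ := fun a b =>
    { toFun := fun A => (A a b).im / Fintype.card I
      map_zero' := by simp
      map_add' := fun A B => by simp [add_div] }
  have hre : ∀ a b, Continuous (reHom a b) := fun a b => by
    change Continuous fun A : Matrix I I ℂ => (A a b).re / (Fintype.card I : ℝ)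
    fun_prop
  have him : ∀ a b, Continuous (imHom a b) := fun a b => by
    change Continuous fun A : Matrix I I ℂ => (A a b).im / (Fintype.card I : ℝ)
    fun_prop
  choose f hf hfi hfA using fun a b => M.exists_density_of_addMonoidHom (reHom a b) (hre a b)
  choose g hg hgi hgA using fun a b => M.exists_density_of_addMonoidHom (imHom a b) (him a b)
  rw [← hμ] at hfi hgi hfA hgA
  set m : X → Matrix I I ℂ := fun x => Matrix.of fun a b => (f a b x : ℂ) + g a b x * Complex.I
    with hm
  have hmi : ∀ a b, Integrable (fun x => m x a b) μ := fun a b =>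
    (hfi a b).ofReal.add ((hgi a b).ofReal.mul_const _)
  have hmA : ∀ a b A, MeasurableSet A →
      ∫ x in A, m x a b ∂μ = M.effect A a b / Fintype.card I := by
    intro a b A hA
    have h1 : ∫ x in A, m x a b ∂μ
        = ((∫ x in A, f a b x ∂μ : ℝ) : ℂ) + ((∫ x in A, g a b x ∂μ : ℝ) : ℂ) * Complex.I := by
      simp only [hm, Matrix.of_apply]
      have hf' : Integrable (fun x => (f a b x : ℂ)) (μ.restrict A) := (hfi a b).ofReal.restrict
      have hg' : Integrable (fun x => (g a b x : ℂ)) (μ.restrict A) := (hgi a b).ofReal.restrict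
      rw [integral_add hf' (hg'.mul_const _), integral_mul_const,
        integral_complex_ofReal, integral_complex_ofReal]
    rw [h1, hfA a b A hA, hgA a b A hA]
    change (((M.effect A a b).re / (Fintype.card I : ℝ) : ℝ) : ℂ)
      + (((M.effect A a b).im / (Fintype.card I : ℝ) : ℝ) : ℂ) * Complex.I = _
    conv_rhs => rw [← Complex.re_add_im (M.effect A a b)]
    push_cast
    ring
  have hset : ∀ (B : Matrix I I ℂ) (A : Set X), MeasurableSet A →
      ∫ x in A, (m x * B).trace.re ∂μ = (M.effect A * B).trace.re / Fintype.card I := by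
    intro B A hA
    rw [integral_trace_mul_re (fun a b => (hmi a b).integrableOn) B]
    have e : (Matrix.of fun a b => ∫ x in A, m x a b ∂μ)
        = (((Fintype.card I : ℝ)⁻¹ : ℝ) : ℂ) • M.effect A := by
      ext a b
      rw [Matrix.of_apply, hmA a b A hA, Matrix.smul_apply, smul_eq_mul]
      push_cast
      ring
    rw [e, Matrix.smul_mul, Matrix.trace_smul, smul_eq_mul, Complex.re_ofReal_mul]
    ring
  have hint : ∀ B : Matrix I I ℂ, Integrable (fun x => (m x * B).trace.re) μ := by
    intro B
    refine Integrable.re (𝕜 := ℂ) (f := fun x => (m x * B).trace) ?_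
    simp only [Matrix.trace, Matrix.diag_apply, Matrix.mul_apply]
    exact integrable_finsetSum _ fun a _ => integrable_finsetSum _ fun b _ =>
      (hmi a b).mul_const _
  have hherm : ∀ᵐ x ∂μ, (m x).IsHermitian := by
    have h : ∀ a b, ∀ᵐ x ∂μ, star (m x b a) = m x a b := by
      intro a b
      refine Integrable.ae_eq_of_forall_setIntegral_eq _ _
        (Complex.conjCLE.toContinuousLinearMap.integrable_comp (hmi b a)) (hmi a b) ?_
      intro A hA _
      have h1 : ∫ x in A, star (m x b a) ∂μ = star (∫ x in A, m x b a ∂μ) := integral_conj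
      rw [h1, hmA b a A hA, hmA a b A hA, ← (M.posSemidef A).isHermitian.apply a b]
      simp
    filter_upwards [ae_all_iff.mpr fun a => ae_all_iff.mpr (h a)] with x hx
    ext a b
    exact hx a b
  refine ⟨m, ⟨fun a b => ?_, hmi, ?_, ?_, hset⟩⟩
  · exact (Complex.measurable_ofReal.comp (hf a b)).add
      ((Complex.measurable_ofReal.comp (hg a b)).mul_const _)
  · have hq : ∀ n, ∀ᵐ x ∂μ, 0 ≤ (m x * Matrix.vecMulVec (TopologicalSpace.denseSeq (I → ℂ) n)
        (star (TopologicalSpace.denseSeq (I → ℂ) n))).trace.re := by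
      intro n
      refine ae_nonneg_of_forall_setIntegral_nonneg (hint _) fun A hA _ => ?_
      rw [hset _ A hA]
      exact div_nonneg (trace_mul_re_nonneg (M.posSemidef A)
        (Matrix.posSemidef_vecMulVec_self_star _)) (Nat.cast_nonneg _)
    filter_upwards [hherm, ae_all_iff.mpr hq] with x h1 h2
    exact posSemidef_of_denseSeq h1 h2
  · have hti : Integrable (fun x => (m x).trace) μ :=
      integrable_finsetSum _ fun a _ => hmi a a
    refine Integrable.ae_eq_of_forall_setIntegral_eq _ (fun _ => (1 : ℂ)) hti
      (integrable_const _) fun A hA _ => ?_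
    have h1 : ∫ x in A, (m x).trace ∂μ = (M.effect A).trace / Fintype.card I := by
      simp only [Matrix.trace, Matrix.diag_apply]
      rw [integral_finsetSum _ fun a _ => (hmi a a).integrableOn, Finset.sum_div]
      exact Finset.sum_congr rfl fun a _ => hmA a a A hA
    rw [h1, setIntegral_const, M.law_maxMixed_real hA]
    have him0 : (M.effect A).trace.im = 0 :=
      ((Complex.le_def.mp (M.posSemidef A).trace_nonneg).2).symm
    refine Complex.ext ?_ ?_
    · simp
    · simp [him0]

namespace IsDensity

variable {M : POVM I X} {m : X → Matrix I I ℂ}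

theorem measurable_trace_mul (h : IsDensity M m) (B : Matrix I I ℂ) :
    Measurable fun x => (m x * B).trace.re := by
  simp only [Matrix.trace, Matrix.diag_apply, Matrix.mul_apply]
  refine Complex.measurable_re.comp ?_
  exact Finset.measurable_fun_sum _ fun a _ => Finset.measurable_fun_sum _ fun b _ =>
    (h.measurable a b).mul_const _

theorem integrable_trace_mul (h : IsDensity M m) (B : Matrix I I ℂ) :
    Integrable (fun x => (m x * B).trace.re) (M.law (QState.maxMixed I)) := by
  refine Integrable.re (𝕜 := ℂ) (f := fun x => (m x * B).trace) ?_
  simp only [Matrix.trace, Matrix.diag_apply, Matrix.mul_apply]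
  exact integrable_finsetSum _ fun a _ => integrable_finsetSum _ fun b _ =>
    (h.integrable a b).mul_const _

theorem integral_trace_mul (h : IsDensity M m) (B : Matrix I I ℂ) :
    ∫ x, (m x * B).trace.re ∂M.law (QState.maxMixed I) = B.trace.re / Fintype.card I := by
  rw [← setIntegral_univ, h.setIntegral B _ MeasurableSet.univ, M.effect_univ, one_mul]

theorem ae_sq_le (h : IsDensity M m) {B : Matrix I I ℂ} (hB : B.IsHermitian) :
    ∀ᵐ x ∂M.law (QState.maxMixed I), (m x * B).trace.re ^ 2 ≤ (m x * (B * B)).trace.re := by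
  filter_upwards [h.posSemidef, h.trace_eq_one] with x h1 h2
  exact trace_mul_sq_le h1 h2 hB

theorem integrable_sq (h : IsDensity M m) {B : Matrix I I ℂ} (hB : B.IsHermitian) :
    Integrable (fun x => (m x * B).trace.re ^ 2) (M.law (QState.maxMixed I)) := by
  refine (h.integrable_trace_mul (B * B)).mono'
    ((h.measurable_trace_mul B).pow_const 2).aestronglyMeasurable ?_
  filter_upwards [h.ae_sq_le hB] with x hx
  rwa [Real.norm_of_nonneg (sq_nonneg _)]

theorem memLp (h : IsDensity M m) {B : Matrix I I ℂ} (hB : B.IsHermitian) :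
    MemLp (fun x => (m x * B).trace.re) 2 (M.law (QState.maxMixed I)) :=
  (memLp_two_iff_integrable_sq (h.measurable_trace_mul B).aestronglyMeasurable).mpr
    (h.integrable_sq hB)

/-- The map sending an observable to its density contracts the normalised Hilbert–Schmidt norm
to the `L²` norm. -/
theorem integral_sq_le (h : IsDensity M m) {B : Matrix I I ℂ} (hB : B.IsHermitian) :
    ∫ x, (m x * B).trace.re ^ 2 ∂M.law (QState.maxMixed I)
      ≤ (B * B).trace.re / Fintype.card I := by
  rw [← h.integral_trace_mul]
  exact integral_mono_ae (h.integrable_sq hB) (h.integrable_trace_mul _) (h.ae_sq_le hB)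

/-- The likelihood ratio of a state against the maximally mixed state. -/
theorem law_eq_withDensity (h : IsDensity M m) (ρ : QState I) :
    M.law ρ = (M.law (QState.maxMixed I)).withDensity fun x =>
      ENNReal.ofReal ((m x * ((Fintype.card I : ℂ) • ρ.mat)).trace.re) := by
  ext A hA
  have hnn : 0 ≤ᵐ[(M.law (QState.maxMixed I)).restrict A]
      fun x => (m x * ((Fintype.card I : ℂ) • ρ.mat)).trace.re := by
    filter_upwards [ae_restrict_of_ae h.posSemidef] with x hx
    exact trace_mul_re_nonneg hx (ρ.posSemidef.smul (by
      rw [← Complex.ofReal_natCast, Complex.zero_le_real]; positivity))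
  rw [withDensity_apply _ hA, ← ofReal_integral_eq_lintegral_ofReal
    (h.integrable_trace_mul _).integrableOn hnn, h.setIntegral _ A hA, M.law_apply ρ hA]
  congr 1
  rw [Matrix.mul_smul, Matrix.trace_smul, smul_eq_mul, ← Complex.ofReal_natCast,
    Complex.re_ofReal_mul]
  have hD : (Fintype.card I : ℝ) ≠ 0 := Nat.cast_ne_zero.mpr Fintype.card_ne_zero
  field_simp

end IsDensity

end Density

/-! ### The second moment method for product measures -/

section SecondMoment

variable {ι : Type*} [Fintype ι] {X : ι → Type*} [∀ i, MeasurableSpace (X i)]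
  {μ : ∀ i, Measure (X i)} [∀ i, IsProbabilityMeasure (μ i)]

/-- A product of measures with densities has the product of the densities as its density. -/
theorem pi_withDensity_ofReal {f : ∀ i, X i → ℝ} (hfi : ∀ i, Integrable (f i) (μ i))
    (h0 : ∀ i, 0 ≤ᵐ[μ i] f i) :
    Measure.pi (fun i => (μ i).withDensity fun x => ENNReal.ofReal (f i x))
      = (Measure.pi μ).withDensity fun x => ENNReal.ofReal (∏ i, f i (x i)) := by
  have hfin : ∀ i, IsFiniteMeasure ((μ i).withDensity fun x => ENNReal.ofReal (f i x)) :=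
    fun i => isFiniteMeasure_withDensity_ofReal (hfi i).2
  refine Measure.pi_eq fun s hs => ?_
  have hprod : 0 ≤ᵐ[Measure.pi fun i => (μ i).restrict (s i)] fun x => ∏ i, f i (x i) := by
    have : ∀ i, ∀ᵐ x ∂Measure.pi fun i => (μ i).restrict (s i), 0 ≤ f i (x i) := fun i =>
      (Measure.quasiMeasurePreserving_eval (μ := fun i => (μ i).restrict (s i)) i).ae
        (ae_restrict_of_ae (h0 i))
    filter_upwards [ae_all_iff.mpr this] with x hx
    exact Finset.prod_nonneg fun i _ => hx i
  rw [withDensity_apply _ (MeasurableSet.univ_pi hs), Measure.restrict_pi_pi,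
    ← ofReal_integral_eq_lintegral_ofReal
      (Integrable.fintype_prod_dep fun i => (hfi i).restrict) hprod,
    integral_fintype_prod_eq_prod, ENNReal.ofReal_prod_of_nonneg fun i _ =>
      integral_nonneg_of_ae (ae_restrict_of_ae (h0 i))]
  refine Finset.prod_congr rfl fun i _ => ?_
  rw [withDensity_apply _ (hs i), ofReal_integral_eq_lintegral_ofReal (hfi i).restrict
    (ae_restrict_of_ae (h0 i))]

theorem integral_expect {Y Z : Type*} [MeasurableSpace Y] [Fintype Z] {ν : Measure Y}
    {F : Z → Y → ℝ} (hF : ∀ z, Integrable (F z) ν) :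
    ∫ x, (𝔼 z, F z x) ∂ν = 𝔼 z, ∫ x, F z x ∂ν := by
  simp only [Fintype.expect_eq_sum_div_card, integral_div]
  rw [integral_finsetSum _ fun z _ => hF z]

theorem integrable_expect {Y Z : Type*} [MeasurableSpace Y] [Fintype Z] {ν : Measure Y}
    {F : Z → Y → ℝ} (hF : ∀ z, Integrable (F z) ν) :
    Integrable (fun x => 𝔼 z, F z x) ν := by
  simp only [Fintype.expect_eq_sum_div_card]
  exact (integrable_finsetSum _ fun z _ => hF z).div_const _

/-- The advantage of any event in telling a product measure from a mixture of product measures is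
at most half of one plus the `χ²`-divergence. It is obtained by integrating the pointwise bound
`g ≤ (1 + g ^ 2) / 2` for `g` equal to one minus the likelihood ratio of the mixture. -/
theorem real_sub_expect_real_le {Z : Type*} [Fintype Z] [Nonempty Z] {f : Z → ∀ i, X i → ℝ}
    (hf : ∀ z i, MemLp (f z i) 2 (μ i)) (h0 : ∀ z i, 0 ≤ᵐ[μ i] f z i)
    (h1 : ∀ z i, ∫ x, f z i x ∂μ i = 1) {A : Set (∀ i, X i)} (hA : MeasurableSet A) :
    (Measure.pi μ).real A
        - 𝔼 z, (Measure.pi fun i => (μ i).withDensity fun x => ENNReal.ofReal (f z i x)).real A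
      ≤ (𝔼 z, 𝔼 w, ∏ i, ∫ x, f z i x * f w i x ∂μ i) / 2 := by
  have hfi : ∀ z i, Integrable (f z i) (μ i) := fun z i => (hf z i).integrable one_le_two
  set Q := Measure.pi μ
  set F : Z → (∀ i, X i) → ℝ := fun z x => ∏ i, f z i (x i) with hF
  have hFi : ∀ z, Integrable (F z) Q := fun z => Integrable.fintype_prod_dep fun i => hfi z i
  have hF0 : ∀ z, 0 ≤ᵐ[Q] F z := by
    intro z
    have : ∀ i, ∀ᵐ x ∂Q, 0 ≤ f z i (x i) := fun i =>
      (Measure.quasiMeasurePreserving_eval (μ := μ) i).ae (h0 z i)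
    filter_upwards [ae_all_iff.mpr this] with x hx
    exact Finset.prod_nonneg fun i _ => hx i
  have hFF : ∀ z w, (fun x => F z x * F w x) = fun x => ∏ i, (f z i (x i) * f w i (x i)) :=
    fun z w => funext fun x => Finset.prod_mul_distrib.symm
  have hFFi : ∀ z w, Integrable (fun x => F z x * F w x) Q := by
    intro z w
    rw [hFF]
    exact Integrable.fintype_prod_dep (f := fun i x => f z i x * f w i x)
      fun i => (hf z i).integrable_mul (hf w i)
  have hP : ∀ z, (Measure.pi fun i =>
      (μ i).withDensity fun x => ENNReal.ofReal (f z i x)).real A = ∫ x in A, F z x ∂Q := by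
    intro z
    rw [pi_withDensity_ofReal (hfi z) (h0 z), Measure.real, withDensity_apply _ hA,
      ← ofReal_integral_eq_lintegral_ofReal (hFi z).restrict (ae_restrict_of_ae (hF0 z)),
      ENNReal.toReal_ofReal (integral_nonneg_of_ae (ae_restrict_of_ae (hF0 z)))]
  have hE : Integrable (fun x => 𝔼 z, F z x) Q := integrable_expect hFi
  have hEE : Integrable (fun x => 𝔼 z, 𝔼 w, F z x * F w x) Q :=
    integrable_expect fun z => integrable_expect fun w => hFFi z w
  set h : (∀ i, X i) → ℝ := fun x => 1 - (𝔼 z, F z x) + (𝔼 z, 𝔼 w, F z x * F w x) / 2 with hh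
  have hhi : Integrable h Q := ((integrable_const _).sub hE).add (hEE.div_const 2)
  have hsq : ∀ x, h x = (1 + (1 - 𝔼 z, F z x) ^ 2) / 2 := by
    intro x
    have : (𝔼 z, 𝔼 w, F z x * F w x) = (𝔼 z, F z x) * 𝔼 w, F w x := by
      simp only [← Finset.mul_expect, ← Finset.expect_mul]
    rw [hh]
    simp only [this]
    ring
  calc (Q.real A - 𝔼 z, (Measure.pi fun i =>
          (μ i).withDensity fun x => ENNReal.ofReal (f z i x)).real A)
      = ∫ x in A, (1 - 𝔼 z, F z x) ∂Q := by
        rw [integral_sub (integrable_const _) hE.restrict,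
          integral_expect fun z => (hFi z).restrict]
        simp only [hP]
        simp
    _ ≤ ∫ x in A, h x ∂Q := by
        refine integral_mono (((integrable_const _).sub hE).restrict) hhi.restrict fun x => ?_
        rw [hsq]
        change (1 - 𝔼 z, F z x) ≤ (1 + (1 - 𝔼 z, F z x) ^ 2) / 2
        nlinarith [sq_nonneg ((1 - 𝔼 z, F z x) - 1)]
    _ ≤ ∫ x, h x ∂Q := setIntegral_le_integral hhi (Filter.Eventually.of_forall fun x => by
        rw [Pi.zero_apply, hsq]; positivity)
    _ = (𝔼 z, 𝔼 w, ∏ i, ∫ x, f z i x * f w i x ∂μ i) / 2 := by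
        have hE1 : Integrable (fun x => 1 - 𝔼 z, F z x) Q := (integrable_const _).sub hE
        simp only [hh]
        rw [integral_add hE1 (hEE.div_const 2), integral_sub (integrable_const _) hE,
          integral_div, integral_expect hFi,
          integral_expect fun z => integrable_expect fun w => hFFi z w]
        simp only [integral_expect fun w => hFFi _ w, hFF]
        have e1 : ∀ z, ∫ x, F z x ∂Q = 1 := fun z => by
          rw [hF, integral_fintype_prod_eq_prod]; simp [h1]
        have e2 : ∀ z w, ∫ x, ∏ i, (f z i (x i) * f w i (x i)) ∂Q
            = ∏ i, ∫ x, f z i x * f w i x ∂μ i := fun z w =>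
          integral_fintype_prod_eq_prod (𝕜 := ℝ) fun i x => f z i x * f w i x
        simp [e1, e2]

end SecondMoment

/-! ### One measurement on a batch of copies -/

section Batch

variable {J : Type} [Fintype J] [DecidableEq J] {k : ℕ}

/-- The linear parts of the likelihood ratios along an orthogonal family of observables are
pointwise bounded: their squares sum to at most the squared norm of the family times `k²`,
whatever its size, because a density is a state and `H ≤ ‖H‖₂`. -/
theorem sum_sq_trace_siteSum_le {α : Type*} [Fintype α] {B : α → Matrix J J ℂ} {β : ℝ}
    (hβ : 0 ≤ β) (hB : ∀ a, (B a).IsHermitian)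
    (hnorm : ∀ u : α → ℝ, ((∑ a, (u a : ℂ) • B a) * ∑ a, (u a : ℂ) • B a).trace
      = (β * ∑ a, u a ^ 2 : ℝ))
    {ρ : Matrix (Fin k → J) (Fin k → J) ℂ} (hρ : ρ.PosSemidef) (hρ1 : ρ.trace = 1) :
    ∑ a, (ρ * siteSum k (B a)).trace.re ^ 2 ≤ k ^ 2 * β := by
  -- Testing the state against the combination with coefficients `u` makes the sum `S` linear.
  set u : α → ℝ := fun a => (ρ * siteSum k (B a)).trace.re with hu
  set S : ℝ := ∑ a, u a ^ 2 with hS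
  have hS0 : 0 ≤ S := Finset.sum_nonneg fun a _ => sq_nonneg _
  set X : Matrix J J ℂ := ∑ a, (u a : ℂ) • B a with hX
  have hXh : X.IsHermitian := by
    rw [Matrix.IsHermitian, hX, Matrix.conjTranspose_sum]
    refine Finset.sum_congr rfl fun a _ => ?_
    rw [Matrix.conjTranspose_smul, (hB a).eq]; simp
  set s : ℝ := Real.sqrt (β * S) with hs
  have hs2 : s ^ 2 = β * S := Real.sq_sqrt (by positivity)
  have h1 : ((s : ℂ) • 1 - X).PosSemidef := by
    refine smul_one_sub_posSemidef hXh (Real.sqrt_nonneg _) ?_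
    rw [hs2, hX, hnorm, Complex.ofReal_re]
  have h2 := trace_mul_re_nonneg hρ (siteSum_le (k := k) h1)
  have h3 : (ρ * siteSum k X).trace.re = S := by
    rw [hX, siteSum_sum, Finset.mul_sum, Matrix.trace_sum, Complex.re_sum]
    refine Finset.sum_congr rfl fun a _ => ?_
    rw [Matrix.mul_smul, Matrix.trace_smul, smul_eq_mul, Complex.re_ofReal_mul, hu, pow_two]
  rw [mul_sub, Matrix.mul_smul, mul_one, Matrix.trace_sub, Matrix.trace_smul, hρ1, smul_eq_mul,
    mul_one, Complex.sub_re, Complex.ofReal_re, h3] at h2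
  change S ≤ _
  rcases hS0.eq_or_lt with h0 | hpos
  · rw [← h0]; positivity
  · have h4 : S * S ≤ (k ^ 2 * β) * S := by
      have h5 : S ≤ k * s := by linarith
      calc S * S ≤ (k * s) * (k * s) := mul_self_le_mul_self hS0 h5
        _ = k ^ 2 * s ^ 2 := by ring
        _ = _ := by rw [hs2]; ring
    exact le_of_mul_le_mul_right h4 hpos

variable [Nonempty J] {X : Type*} [MeasurableSpace X] {M : POVM (Fin k → J) X}
  {m : X → Matrix (Fin k → J) (Fin k → J) ℂ}

theorem one_add_pow_sub_le {u : ℝ} (hu : 0 ≤ u) (h : k * u ≤ 1) :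
    (1 + u) ^ k - 1 - k * u ≤ (k * u) ^ 2 := by
  have h1 : (1 + u) ^ k ≤ Real.exp (k * u) := by
    rw [Real.exp_nat_mul]
    exact pow_le_pow_left₀ (by linarith) (by linarith [Real.add_one_le_exp u]) k
  have h2 := Real.abs_exp_sub_one_sub_id_le (x := k * u) (by rwa [abs_of_nonneg (by positivity)])
  linarith [(abs_le.mp h2).2]

theorem IsDensity.integral_siteSum_sq_le (h : IsDensity M m) {H : Matrix J J ℂ}
    (hH : H.IsHermitian) (htr : H.trace = 0) {s : ℝ} (hs : (H * H).trace = s) :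
    ∫ x, (m x * siteSum k H).trace.re ^ 2 ∂M.law (QState.maxMixed _)
      ≤ k * s / Fintype.card J := by
  refine (h.integral_sq_le (siteSum_isHermitian hH)).trans (le_of_eq ?_)
  have hD : (Fintype.card J : ℝ) ^ k ≠ 0 :=
    pow_ne_zero _ (Nat.cast_ne_zero.mpr Fintype.card_ne_zero)
  rw [trace_siteSum_mul_siteSum htr, hs]
  have : (Fintype.card J : ℂ) ^ k * (k * ((s : ℂ) / Fintype.card J))
      = (((Fintype.card J : ℝ) ^ k * (k * (s / Fintype.card J)) : ℝ) : ℂ) := by push_cast; rfl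
  rw [this, Complex.ofReal_re]
  simp only [Fintype.card_fun, Fintype.card_fin, Nat.cast_pow]
  field_simp

theorem IsDensity.integral_tensorRem_sq_le (h : IsDensity M m) {H : Matrix J J ℂ}
    (hH : H.IsHermitian) (htr : H.trace = 0) (hs : (H * H).trace = Fintype.card J) {a : ℝ}
    (ha : k * a ^ 2 ≤ 1) :
    ∫ x, (m x * tensorRem k ((a : ℂ) • H)).trace.re ^ 2 ∂M.law (QState.maxMixed _)
      ≤ (k * a ^ 2) ^ 2 := by
  have hD : (Fintype.card J : ℝ) ^ k ≠ 0 :=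
    pow_ne_zero _ (Nat.cast_ne_zero.mpr Fintype.card_ne_zero)
  have hX : ((a : ℂ) • H).IsHermitian := by
    rw [Matrix.IsHermitian, Matrix.conjTranspose_smul, hH.eq]; simp
  have hXtr : ((a : ℂ) • H).trace = 0 := by rw [Matrix.trace_smul, htr, smul_zero]
  refine (h.integral_sq_le (tensorRem_isHermitian hX)).trans ?_
  refine le_trans (le_of_eq ?_) (one_add_pow_sub_le (sq_nonneg a) ha)
  rw [trace_tensorRem_sq hXtr]
  have e : ((a : ℂ) • H * (a : ℂ) • H).trace / Fintype.card J = ((a ^ 2 : ℝ) : ℂ) := by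
    rw [Matrix.smul_mul, Matrix.mul_smul, smul_smul, Matrix.trace_smul, hs, smul_eq_mul]
    have := card_ne_zero_complex (I := J)
    field_simp
    push_cast
    rfl
  rw [e]
  have : (Fintype.card J : ℂ) ^ k * ((1 + ((a ^ 2 : ℝ) : ℂ)) ^ k - 1 - k * ((a ^ 2 : ℝ) : ℂ))
      = (((Fintype.card J : ℝ) ^ k * ((1 + a ^ 2) ^ k - 1 - k * a ^ 2) : ℝ) : ℂ) := by
    push_cast; rfl
  rw [this, Complex.ofReal_re]
  simp only [Fintype.card_fun, Fintype.card_fin, Nat.cast_pow]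
  field_simp

/-- The correlation of the likelihood ratios of `k` copies of the states with densities
proportional to `1 + a H` and `1 + a H'`: the terms linear in both `H` and `H'` dominate, and the
remaining ones contribute at most `3 k² a³`. -/
theorem IsDensity.integral_tensorPow_mul_le (h : IsDensity M m) {H H' : Matrix J J ℂ}
    (hH : H.IsHermitian) (htr : H.trace = 0) (hs : (H * H).trace = Fintype.card J)
    (hH' : H'.IsHermitian) (htr' : H'.trace = 0) (hs' : (H' * H').trace = Fintype.card J)
    (hk : 1 ≤ k) {a : ℝ} (ha0 : 0 < a) (ha1 : a ≤ 1) (ha : k * a ^ 2 ≤ 1) :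
    ∫ x, (m x * tensorPow (1 + (a : ℂ) • H) k).trace.re
          * (m x * tensorPow (1 + (a : ℂ) • H') k).trace.re ∂M.law (QState.maxMixed _)
      ≤ 1 + a ^ 2 * ∫ x, (m x * siteSum k H).trace.re * (m x * siteSum k H').trace.re
          ∂M.law (QState.maxMixed _) + 3 * k ^ 2 * a ^ 3 := by
  set μ := M.law (QState.maxMixed (Fin k → J))
  have hherm : ∀ {H : Matrix J J ℂ}, H.IsHermitian → ((a : ℂ) • H).IsHermitian := by
    intro H hH
    rw [Matrix.IsHermitian, Matrix.conjTranspose_smul, hH.eq]; simp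
  set φ : Matrix J J ℂ → X → ℝ := fun H x => (m x * siteSum k H).trace.re with hφ
  set r : Matrix J J ℂ → X → ℝ := fun H x => (m x * tensorRem k ((a : ℂ) • H)).trace.re with hr
  set f : Matrix J J ℂ → X → ℝ := fun H x => (m x * tensorPow (1 + (a : ℂ) • H) k).trace.re
    with hf
  have hdec : ∀ H, ∀ᵐ x ∂μ, f H x = 1 + a * φ H x + r H x := by
    intro H
    filter_upwards [h.trace_eq_one] with x hx
    have e : m x * tensorPow (1 + (a : ℂ) • H) k
        = m x + (a : ℂ) • (m x * siteSum k H) + m x * tensorRem k ((a : ℂ) • H) := by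
      rw [tensorRem, siteSum_smul, mul_sub, mul_sub, mul_one, Matrix.mul_smul]
      abel
    simp only [hf, hφ, hr, e, Matrix.trace_add, Matrix.trace_smul, hx, smul_eq_mul,
      Complex.add_re, Complex.re_ofReal_mul, Complex.one_re]
  have hf1 : ∀ {H : Matrix J J ℂ}, H.trace = 0 → ∫ x, f H x ∂μ = 1 := by
    intro H hH
    have e : (tensorPow (1 + (a : ℂ) • H) k).trace = (((Fintype.card J : ℝ) ^ k : ℝ) : ℂ) := by
      rw [tensorPow_trace, Matrix.trace_add, Matrix.trace_smul, hH, Matrix.trace_one]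
      simp
    rw [hf, h.integral_trace_mul, e, Complex.ofReal_re]
    have hD : (Fintype.card J : ℝ) ^ k ≠ 0 :=
      pow_ne_zero _ (Nat.cast_ne_zero.mpr Fintype.card_ne_zero)
    simp only [Fintype.card_fun, Fintype.card_fin, Nat.cast_pow]
    exact div_self hD
  have hfi : ∀ H, Integrable (f H) μ := fun H => h.integrable_trace_mul _
  have hφ2 : ∀ {H : Matrix J J ℂ}, H.IsHermitian → MemLp (φ H) 2 μ :=
    fun hH => h.memLp (siteSum_isHermitian hH)
  have hr2 : ∀ {H : Matrix J J ℂ}, H.IsHermitian → MemLp (r H) 2 μ :=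
    fun hH => h.memLp (tensorRem_isHermitian (hherm hH))
  have hφφ : Integrable (fun x => φ H x * φ H' x) μ := (hφ2 hH).integrable_mul (hφ2 hH')
  have b1 : ∫ x, φ H x ^ 2 ∂μ ≤ k := by
    refine (h.integral_siteSum_sq_le hH htr (s := Fintype.card J) (by rw [hs]; simp)).trans
      (le_of_eq ?_)
    have hD : (Fintype.card J : ℝ) ≠ 0 := Nat.cast_ne_zero.mpr Fintype.card_ne_zero
    field_simp
  have b1' : ∫ x, φ H' x ^ 2 ∂μ ≤ k := by
    refine (h.integral_siteSum_sq_le hH' htr' (s := Fintype.card J) (by rw [hs']; simp)).trans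
      (le_of_eq ?_)
    have hD : (Fintype.card J : ℝ) ≠ 0 := Nat.cast_ne_zero.mpr Fintype.card_ne_zero
    field_simp
  have b2 : ∫ x, r H x ^ 2 ∂μ ≤ (k * a ^ 2) ^ 2 := h.integral_tensorRem_sq_le hH htr hs ha
  have b2' : ∫ x, r H' x ^ 2 ∂μ ≤ (k * a ^ 2) ^ 2 := h.integral_tensorRem_sq_le hH' htr' hs' ha
  have i1 := (hφ2 hH).integrable_sq
  have i1' := (hφ2 hH').integrable_sq
  have i2 := (hr2 hH).integrable_sq
  have i2' := (hr2 hH').integrable_sq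
  have e0 : ∀ p q : ℝ, p * q ≤ (a * p ^ 2 + q ^ 2 / a) / 2 := by
    intro p q
    have : (a * p ^ 2 + q ^ 2 / a) / 2 - p * q = (a * p - q) ^ 2 / (2 * a) := by
      field_simp; ring
    nlinarith [show 0 ≤ (a * p - q) ^ 2 / (2 * a) by positivity]
  -- The mixed terms are split by the weighted AM-GM inequality with weight `a`.
  have hpt : ∀ᵐ x ∂μ, f H x * f H' x ≤ (f H x + f H' x - 1) + (a ^ 2 * (φ H x * φ H' x)
      + ((a ^ 3 / 2) * φ H x ^ 2 + (a ^ 3 / 2) * φ H' x ^ 2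
      + ((1 / (2 * a) + 1 / 2) * r H x ^ 2 + (1 / (2 * a) + 1 / 2) * r H' x ^ 2))) := by
    filter_upwards [hdec H, hdec H'] with x hx hx'
    rw [hx, hx']
    have e1 := e0 (a * φ H x) (r H' x)
    have e2 := e0 (a * φ H' x) (r H x)
    have e3 : r H x * r H' x ≤ (r H x ^ 2 + r H' x ^ 2) / 2 := by
      nlinarith [sq_nonneg (r H x - r H' x)]
    have e4 : ∀ q : ℝ, (1 / (2 * a) + 1 / 2) * q = (q / a) / 2 + q / 2 := by
      intro q; field_simp
    rw [e4, e4]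
    nlinarith
  have iA : Integrable (fun x => a ^ 2 * (φ H x * φ H' x)) μ := hφφ.const_mul _
  have iB : Integrable (fun x => (a ^ 3 / 2) * φ H x ^ 2 + (a ^ 3 / 2) * φ H' x ^ 2) μ :=
    (i1.const_mul _).add (i1'.const_mul _)
  have iC : Integrable (fun x => (1 / (2 * a) + 1 / 2) * r H x ^ 2
      + (1 / (2 * a) + 1 / 2) * r H' x ^ 2) μ := (i2.const_mul _).add (i2'.const_mul _)
  have iBC : Integrable (fun x => (a ^ 3 / 2) * φ H x ^ 2 + (a ^ 3 / 2) * φ H' x ^ 2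
      + ((1 / (2 * a) + 1 / 2) * r H x ^ 2 + (1 / (2 * a) + 1 / 2) * r H' x ^ 2)) μ := iB.add iC
  have iABC : Integrable (fun x => a ^ 2 * (φ H x * φ H' x)
      + ((a ^ 3 / 2) * φ H x ^ 2 + (a ^ 3 / 2) * φ H' x ^ 2
      + ((1 / (2 * a) + 1 / 2) * r H x ^ 2 + (1 / (2 * a) + 1 / 2) * r H' x ^ 2))) μ := iA.add iBC
  have iF : Integrable (fun x => f H x + f H' x) μ := (hfi H).add (hfi H')
  have iL : Integrable (fun x => f H x + f H' x - 1) μ := iF.sub (integrable_const _)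
  have hff : Integrable (fun x => f H x * f H' x) μ := by
    have hm : ∀ {H : Matrix J J ℂ}, H.IsHermitian → MemLp (f H) 2 μ := by
      intro H hH
      refine h.memLp ?_
      rw [Matrix.IsHermitian, tensorPow_eq_tensorFam, tensorFam_conjTranspose]
      simp [hH.eq]
    exact (hm hH).integrable_mul (hm hH')
  refine (integral_mono_ae hff (iL.add iABC) hpt).trans ?_
  have hk1 : (1 : ℝ) ≤ k := by exact_mod_cast hk
  have eval : ∫ x, (f H x + f H' x - 1) + (a ^ 2 * (φ H x * φ H' x)
      + ((a ^ 3 / 2) * φ H x ^ 2 + (a ^ 3 / 2) * φ H' x ^ 2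
      + ((1 / (2 * a) + 1 / 2) * r H x ^ 2 + (1 / (2 * a) + 1 / 2) * r H' x ^ 2))) ∂μ
      = 1 + (a ^ 2 * (∫ x, φ H x * φ H' x ∂μ)
      + ((a ^ 3 / 2) * (∫ x, φ H x ^ 2 ∂μ) + (a ^ 3 / 2) * (∫ x, φ H' x ^ 2 ∂μ)
      + ((1 / (2 * a) + 1 / 2) * (∫ x, r H x ^ 2 ∂μ)
        + (1 / (2 * a) + 1 / 2) * (∫ x, r H' x ^ 2 ∂μ)))) := by
    rw [integral_add iL iABC, integral_add iA iBC, integral_add iB iC,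
      integral_add (i1.const_mul _) (i1'.const_mul _),
      integral_add (i2.const_mul _) (i2'.const_mul _),
      integral_sub iF (integrable_const _), integral_add (hfi H) (hfi H'),
      hf1 htr, hf1 htr']
    simp only [integral_const_mul]
    simp
  change ∫ x, (f H x + f H' x - 1) + (a ^ 2 * (φ H x * φ H' x)
      + ((a ^ 3 / 2) * φ H x ^ 2 + (a ^ 3 / 2) * φ H' x ^ 2
      + ((1 / (2 * a) + 1 / 2) * r H x ^ 2 + (1 / (2 * a) + 1 / 2) * r H' x ^ 2))) ∂μ ≤ _
  rw [eval]
  have c0 : 0 ≤ 1 / (2 * a) + 1 / 2 := by positivity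
  have c1 : 0 ≤ a ^ 3 / 2 := by positivity
  have d1 := mul_le_mul_of_nonneg_left b1 c1
  have d1' := mul_le_mul_of_nonneg_left b1' c1
  have d2 := mul_le_mul_of_nonneg_left b2 c0
  have d2' := mul_le_mul_of_nonneg_left b2' c0
  have e5 : (1 / (2 * a) + 1 / 2) * (k * a ^ 2) ^ 2 = (k ^ 2 * a ^ 3 + k ^ 2 * a ^ 4) / 2 := by
    field_simp
  have e6 : (k : ℝ) ^ 2 * a ^ 4 ≤ k ^ 2 * a ^ 3 := by
    refine mul_le_mul_of_nonneg_left ?_ (by positivity)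
    nlinarith [pow_pos ha0 3]
  have e7 : a ^ 3 * (k : ℝ) ≤ k ^ 2 * a ^ 3 := by
    nlinarith [pow_pos ha0 3, mul_nonneg (pow_pos ha0 3).le (by linarith : (0 : ℝ) ≤ k)]
  linarith

end Batch

/-! ### Schedules of measurements against a random state -/

section Schedule

variable {J α : Type} [Fintype J] [Fintype α]

/-- The observable with real coordinates `u` along the family `B`. -/
def realComb (B : α → Matrix J J ℂ) (u : α → ℝ) : Matrix J J ℂ := ∑ a, (u a : ℂ) • B a

/-- `B` is a family of traceless Hermitian matrices that are orthogonal, all of squared norm `β`,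
for the Hilbert–Schmidt inner product. -/
structure IsOrthogonalFamily [DecidableEq α] (B : α → Matrix J J ℂ) (β : ℝ) : Prop where
  nonneg : 0 ≤ β
  isHermitian : ∀ a, (B a).IsHermitian
  trace_eq_zero : ∀ a, (B a).trace = 0
  trace_mul : ∀ a b, (B a * B b).trace = if a = b then (β : ℂ) else 0

variable {B : α → Matrix J J ℂ} {β : ℝ}

namespace IsOrthogonalFamily

variable [DecidableEq α]

theorem realComb_isHermitian (h : IsOrthogonalFamily B β) (u : α → ℝ) :
    (realComb B u).IsHermitian := by
  rw [Matrix.IsHermitian, realComb, Matrix.conjTranspose_sum]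
  refine Finset.sum_congr rfl fun a _ => ?_
  rw [Matrix.conjTranspose_smul, (h.isHermitian a).eq]; simp

theorem trace_realComb (h : IsOrthogonalFamily B β) (u : α → ℝ) : (realComb B u).trace = 0 := by
  simp [realComb, Matrix.trace_sum, Matrix.trace_smul, h.trace_eq_zero]

theorem trace_realComb_mul_self (h : IsOrthogonalFamily B β) (u : α → ℝ) :
    (realComb B u * realComb B u).trace = (β * ∑ a, u a ^ 2 : ℝ) := by
  simp only [realComb, Finset.sum_mul, Finset.mul_sum, Matrix.trace_sum, Matrix.smul_mul,
    Matrix.mul_smul, Matrix.trace_smul, h.trace_mul, smul_eq_mul, mul_ite, mul_zero]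
  simp only [Finset.sum_ite_eq', Finset.mem_univ, if_true]
  push_cast
  exact Finset.sum_congr rfl fun a _ => by ring

theorem trace_sign_mul_self (h : IsOrthogonalFamily B β) {D : ℕ} (hD : β * Fintype.card α = D)
    (z : α → ℤˣ) : (realComb B (fun a => signVal (z a)) * realComb B fun a => signVal (z a)).trace
      = D := by
  rw [h.trace_realComb_mul_self]
  have : ∑ a, signVal (z a) ^ 2 = Fintype.card α := by
    simp [pow_two, signVal_mul_self]
  rw [this, hD]
  simp

end IsOrthogonalFamily

variable [DecidableEq J]

theorem trace_mul_siteSum_realComb {k : ℕ} (ρ : Matrix (Fin k → J) (Fin k → J) ℂ) (u : α → ℝ) :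
    (ρ * siteSum k (realComb B u)).trace.re = ∑ a, u a * (ρ * siteSum k (B a)).trace.re := by
  rw [realComb, siteSum_sum, Finset.mul_sum, Matrix.trace_sum, Complex.re_sum]
  refine Finset.sum_congr rfl fun a _ => ?_
  rw [Matrix.mul_smul, Matrix.trace_smul, smul_eq_mul, Complex.re_ofReal_mul]

variable [DecidableEq α] [Nonempty J]

theorem IsDensity.integral_siteSum_realComb_mul {k : ℕ} {X : Type*} [MeasurableSpace X]
    {M : POVM (Fin k → J) X} {m : X → Matrix (Fin k → J) (Fin k → J) ℂ} (h : IsDensity M m)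
    (hB : IsOrthogonalFamily B β) (u v : α → ℝ) :
    ∫ x, (m x * siteSum k (realComb B u)).trace.re * (m x * siteSum k (realComb B v)).trace.re
        ∂M.law (QState.maxMixed _)
      = ∑ a, ∑ b, u a * v b * ∫ x, (m x * siteSum k (B a)).trace.re
          * (m x * siteSum k (B b)).trace.re ∂M.law (QState.maxMixed _) := by
  have hi : ∀ a b, Integrable (fun x => u a * v b * ((m x * siteSum k (B a)).trace.re
      * (m x * siteSum k (B b)).trace.re)) (M.law (QState.maxMixed _)) := fun a b =>
    ((h.memLp (siteSum_isHermitian (hB.isHermitian a))).integrable_mul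
      (h.memLp (siteSum_isHermitian (hB.isHermitian b)))).const_mul _
  simp only [trace_mul_siteSum_realComb, Finset.sum_mul_sum]
  simp only [mul_mul_mul_comm (u _)]
  rw [integral_finsetSum _ fun a _ => integrable_finsetSum _ fun b _ => hi a b]
  refine Finset.sum_congr rfl fun a _ => ?_
  rw [integral_finsetSum _ fun b _ => hi a b]
  exact Finset.sum_congr rfl fun b _ => integral_const_mul _ _

/-- A non-adaptive schedule of measurements with `N` copies in total and at most `t` copies in
each batch tells the maximally mixed state from a random state `(1 + a ∑ ± B) / D` with an
advantage controlled by the Frobenius norm of the Gram matrix `G` of the linear parts of the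
likelihood ratios. This norm is bounded through `G ≤ N β / D` and `tr G ≤ T`. -/
theorem real_sub_expect_law_le {n : ℕ} {size : Fin n → ℕ} {Y : Fin n → Type*}
    [∀ i, MeasurableSpace (Y i)] (M : ∀ i, POVM (Fin (size i) → J) (Y i))
    (hB : IsOrthogonalFamily B β) (hcard : β * Fintype.card α = Fintype.card J) {t N : ℕ}
    (h1 : ∀ i, 1 ≤ size i) (ht : ∀ i, size i ≤ t) (hN : ∑ i, size i ≤ N) {a : ℝ} (ha0 : 0 < a)
    (ha1 : a ≤ 1) (hta : t * a ^ 2 ≤ 1) {ρ : (α → ℤˣ) → QState J}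
    (hρ : ∀ z, (ρ z).mat = (Fintype.card J : ℂ)⁻¹ •
      (1 + (a : ℂ) • realComb B fun b => signVal (z b)))
    {T : ℝ} (hT : t * N * β ≤ T ∨ Fintype.card α * (N * β / Fintype.card J) ≤ T)
    (hsmall : a ^ 4 * (N * β / Fintype.card J * T) ≤ 1 / 2)
    {A : Set (∀ i, Y i)} (hA : MeasurableSet A) :
    (Measure.pi fun i => (M i).law ((QState.maxMixed J).copies (size i))).real A
        - 𝔼 z, (Measure.pi fun i => (M i).law ((ρ z).copies (size i))).real A
      ≤ Real.exp (3 * a ^ 3 * t * N + a ^ 4 * (N * β / Fintype.card J * T)) / 2 := by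
  choose m hm using fun i => (M i).exists_isDensity
  have hβ := hB.nonneg
  have hD : (0 : ℝ) < Fintype.card J := Nat.cast_pos.mpr Fintype.card_pos
  have hDc := card_ne_zero_complex (I := J)
  set H : (α → ℤˣ) → Matrix J J ℂ := fun z => realComb B fun b => signVal (z b) with hH
  have hHh : ∀ z, (H z).IsHermitian := fun z => hB.realComb_isHermitian _
  have hHt : ∀ z, (H z).trace = 0 := fun z => hB.trace_realComb _
  have hHs : ∀ z, (H z * H z).trace = Fintype.card J := fun z => hB.trace_sign_mul_self hcard z
  set μ : ∀ i, Measure (Y i) := fun i => (M i).law (QState.maxMixed (Fin (size i) → J)) with hμ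
  set f : (α → ℤˣ) → ∀ i, Y i → ℝ := fun z i x =>
    (m i x * tensorPow (1 + (a : ℂ) • H z) (size i)).trace.re with hf
  have hmat : ∀ z i, (Fintype.card (Fin (size i) → J) : ℂ) • ((ρ z).copies (size i)).mat
      = tensorPow (1 + (a : ℂ) • H z) (size i) := by
    intro z i
    change _ • tensorPow (ρ z).mat (size i) = _
    rw [hρ, tensorPow_smul, smul_smul]
    simp only [Fintype.card_fun, Fintype.card_fin, Nat.cast_pow]
    rw [← mul_pow, mul_inv_cancel₀ hDc, one_pow, one_smul]
  have hlaw : ∀ z i, (M i).law ((ρ z).copies (size i))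
      = (μ i).withDensity fun x => ENNReal.ofReal (f z i x) := by
    intro z i
    rw [(hm i).law_eq_withDensity, hmat]
  have hf0 : ∀ z i, 0 ≤ᵐ[μ i] f z i := by
    intro z i
    filter_upwards [(hm i).posSemidef] with x hx
    simp only [hf, Pi.zero_apply]
    rw [← hmat]
    refine trace_mul_re_nonneg hx (((ρ z).copies (size i)).posSemidef.smul ?_)
    rw [← Complex.ofReal_natCast, Complex.zero_le_real]; positivity
  have hf1 : ∀ z i, ∫ x, f z i x ∂μ i = 1 := by
    intro z i
    simp only [hf, hμ]
    rw [(hm i).integral_trace_mul, ← hmat, Matrix.trace_smul, QState.trace_eq_one, smul_eq_mul,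
      mul_one, Complex.natCast_re]
    exact div_self (Nat.cast_ne_zero.mpr Fintype.card_ne_zero)
  have hf2 : ∀ z i, MemLp (f z i) 2 (μ i) := by
    intro z i
    refine (hm i).memLp ?_
    rw [← hmat, Matrix.IsHermitian, Matrix.conjTranspose_smul,
      ((ρ z).copies (size i)).posSemidef.isHermitian.eq]
    simp
  simp only [QState.copies_maxMixed, hlaw]
  refine (real_sub_expect_real_le hf2 hf0 hf1 hA).trans ?_
  refine div_le_div_of_nonneg_right ?_ two_pos.le
  set g : Fin n → α → α → ℝ := fun i b c => ∫ x, (m i x * siteSum (size i) (B b)).trace.re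
    * (m i x * siteSum (size i) (B c)).trace.re ∂μ i with hg
  set G : α → α → ℝ := fun b c => ∑ i, g i b c with hG
  have hgb : ∀ i (u v : α → ℝ), ∫ x, (m i x * siteSum (size i) (realComb B u)).trace.re
      * (m i x * siteSum (size i) (realComb B v)).trace.re ∂μ i
      = ∑ b, ∑ c, u b * v c * g i b c := fun i u v =>
    (hm i).integral_siteSum_realComb_mul hB u v
  have hGb : ∀ u v : α → ℝ, ∑ b, ∑ c, u b * v c * G b c
      = ∑ i, ∑ b, ∑ c, u b * v c * g i b c := by
    intro u v
    simp only [hG, Finset.mul_sum]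
    exact (Finset.sum_comm.trans (Finset.sum_congr rfl fun b _ => Finset.sum_comm)).symm
  have hsum : ∑ i, (size i : ℝ) ≤ N := by exact_mod_cast hN
  have hsum2 : ∑ i, (size i : ℝ) ^ 2 ≤ t * N := by
    calc ∑ i, (size i : ℝ) ^ 2 ≤ ∑ i, t * (size i : ℝ) := by
          refine Finset.sum_le_sum fun i _ => ?_
          rw [pow_two]
          exact mul_le_mul_of_nonneg_right (by exact_mod_cast ht i) (Nat.cast_nonneg _)
      _ = t * ∑ i, (size i : ℝ) := (Finset.mul_sum ..).symm
      _ ≤ t * N := by gcongr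
  set K : ℝ := N * β / Fintype.card J with hK
  have hK0 : 0 ≤ K := by positivity
  have hGsymm : ∀ b c, G b c = G c b := fun b c => by
    simp only [hG, hg, mul_comm]
  have hGnn : ∀ v : α → ℝ, 0 ≤ ∑ b, ∑ c, v b * v c * G b c := by
    intro v
    rw [hGb]
    refine Finset.sum_nonneg fun i _ => ?_
    rw [← hgb]
    exact integral_nonneg fun x => mul_self_nonneg _
  have hGle : ∀ v : α → ℝ, ∑ b, ∑ c, v b * v c * G b c ≤ K * ∑ b, v b ^ 2 := by
    intro v
    rw [hGb]
    have hi : ∀ i, ∑ b, ∑ c, v b * v c * g i b c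
        ≤ size i * (β * ∑ b, v b ^ 2) / Fintype.card J := by
      intro i
      rw [← hgb]
      simp only [← pow_two]
      exact (hm i).integral_siteSum_sq_le (hB.realComb_isHermitian v) (hB.trace_realComb v)
        (hB.trace_realComb_mul_self v)
    refine (Finset.sum_le_sum fun i _ => hi i).trans ?_
    rw [← Finset.sum_div, ← Finset.sum_mul, hK]
    have hv : 0 ≤ ∑ b, v b ^ 2 := Finset.sum_nonneg fun b _ => sq_nonneg _
    calc (∑ i, (size i : ℝ)) * (β * ∑ b, v b ^ 2) / Fintype.card J
        ≤ N * (β * ∑ b, v b ^ 2) / Fintype.card J := by gcongr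
      _ = _ := by ring
  have hGtr : ∑ b, G b b ≤ T := by
    rcases hT with hT | hT
    · refine le_trans ?_ hT
      simp only [hG]
      rw [Finset.sum_comm]
      have hi : ∀ i, ∑ b, g i b b ≤ (size i : ℝ) ^ 2 * β := by
        intro i
        have hint : ∀ b, Integrable (fun x => (m i x * siteSum (size i) (B b)).trace.re ^ 2)
            (μ i) := fun b => (hm i).integrable_sq (siteSum_isHermitian (hB.isHermitian b))
        simp only [hg, ← pow_two]
        rw [← integral_finsetSum _ fun b _ => hint b]
        have hle : ∀ᵐ x ∂μ i, ∑ b, (m i x * siteSum (size i) (B b)).trace.re ^ 2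
            ≤ (size i : ℝ) ^ 2 * β := by
          filter_upwards [(hm i).posSemidef, (hm i).trace_eq_one] with x hx hx'
          exact sum_sq_trace_siteSum_le hβ hB.isHermitian hB.trace_realComb_mul_self hx hx'
        refine (integral_mono_ae (integrable_finsetSum _ fun b _ => hint b)
          (integrable_const _) hle).trans (le_of_eq ?_)
        simp
      refine (Finset.sum_le_sum fun i _ => hi i).trans ?_
      rw [← Finset.sum_mul]
      gcongr
    · refine le_trans ?_ hT
      have hb : ∀ b, G b b ≤ K := by
        intro b
        have h := hGle (Pi.single b 1)
        have e1 : ∑ c, ∑ c', (Pi.single b 1 : α → ℝ) c * (Pi.single b 1 : α → ℝ) c' * G c c'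
            = G b b := by
          rw [Finset.sum_eq_single b]
          · rw [Finset.sum_eq_single b] <;> simp +contextual
          · intro c _ hc; simp [hc]
          · simp
        have e2 : ∑ c, (Pi.single b 1 : α → ℝ) c ^ 2 = 1 := by
          rw [Finset.sum_eq_single b] <;> simp +contextual
        rwa [e1, e2, mul_one] at h
      refine (Finset.sum_le_sum fun b _ => hb b).trans (le_of_eq ?_)
      simp
  have hGF : ∑ b, ∑ c, (a ^ 2 * G b c) ^ 2 ≤ a ^ 4 * (K * T) := by
    have e : ∀ b c, (a ^ 2 * G b c) ^ 2 = a ^ 4 * G b c ^ 2 := fun b c => by ring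
    simp only [e, ← Finset.mul_sum]
    gcongr
    exact (sum_sq_le_mul_trace hGsymm hGnn hGle).trans (by gcongr)
  have hprod : ∀ z w, ∏ i, ∫ x, f z i x * f w i x ∂μ i ≤ Real.exp (3 * a ^ 3 * t * N)
      * Real.exp (∑ b, ∑ c, a ^ 2 * G b c * signVal (z b) * signVal (w c)) := by
    intro z w
    have hi : ∀ i, ∫ x, f z i x * f w i x ∂μ i
        ≤ Real.exp (a ^ 2 * ∑ b, ∑ c, signVal (z b) * signVal (w c) * g i b c
          + 3 * (size i : ℝ) ^ 2 * a ^ 3) := by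
      intro i
      have hka : (size i : ℝ) * a ^ 2 ≤ 1 := by
        refine le_trans ?_ hta
        gcongr
        exact ht i
      have h := (hm i).integral_tensorPow_mul_le (hHh z) (hHt z) (hHs z) (hHh w) (hHt w) (hHs w)
        (h1 i) ha0 ha1 hka
      rw [← hgb]
      refine h.trans ?_
      refine le_trans (le_of_eq ?_) (Real.add_one_le_exp _)
      ring
    refine (Finset.prod_le_prod (fun i _ => integral_nonneg_of_ae ?_) fun i _ => hi i).trans ?_
    · filter_upwards [hf0 z i, hf0 w i] with x hx hx'
      exact mul_nonneg hx hx'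
    · rw [← Real.exp_sum, ← Real.exp_add, Finset.sum_add_distrib, ← Finset.mul_sum, ← hGb]
      apply Real.exp_le_exp.mpr
      have e1 : ∑ b, ∑ c, a ^ 2 * G b c * signVal (z b) * signVal (w c)
          = a ^ 2 * ∑ b, ∑ c, signVal (z b) * signVal (w c) * G b c := by
        simp only [Finset.mul_sum]
        exact Finset.sum_congr rfl fun b _ => Finset.sum_congr rfl fun c _ => by ring
      have e2 : ∑ i, 3 * (size i : ℝ) ^ 2 * a ^ 3 = 3 * a ^ 3 * ∑ i, (size i : ℝ) ^ 2 := by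
        rw [Finset.mul_sum]
        exact Finset.sum_congr rfl fun i _ => by ring
      rw [e1, e2, mul_assoc (3 * a ^ 3)]
      have : 3 * a ^ 3 * ∑ i, (size i : ℝ) ^ 2 ≤ 3 * a ^ 3 * (t * N) := by gcongr
      linarith
  calc (𝔼 z, 𝔼 w, ∏ i, ∫ x, f z i x * f w i x ∂μ i)
      ≤ 𝔼 z : α → ℤˣ, 𝔼 w : α → ℤˣ, Real.exp (3 * a ^ 3 * t * N)
        * Real.exp (∑ b, ∑ c, a ^ 2 * G b c * signVal (z b) * signVal (w c)) :=
        Finset.expect_le_expect fun z _ => Finset.expect_le_expect fun w _ => hprod z w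
    _ = Real.exp (3 * a ^ 3 * t * N) * 𝔼 z : α → ℤˣ, 𝔼 w : α → ℤˣ,
        Real.exp (∑ b, ∑ c, a ^ 2 * G b c * signVal (z b) * signVal (w c)) := by
        simp only [← Finset.mul_expect]
    _ ≤ Real.exp (3 * a ^ 3 * t * N) * Real.exp (a ^ 4 * (K * T)) := by
        gcongr
        refine (expect_exp_bilinear_le (fun b c => a ^ 2 * G b c)
          (hGF.trans hsmall)).trans ?_
        exact Real.exp_le_exp.mpr hGF
    _ = _ := (Real.exp_add _ _).symm

end Schedule

/-! ### Isometric embeddings of states -/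

section Embedding

variable {I J : Type} [Fintype I]

theorem tensorFam_mul_conjTranspose_eq_one [DecidableEq J] {V : Matrix J I ℂ}
    (hV : V * V.conjTranspose = 1) (k : ℕ) :
    tensorFam (fun _ : Fin k => V) * (tensorFam fun _ : Fin k => V).conjTranspose = 1 := by
  rw [tensorFam_conjTranspose, tensorFam_mul, hV, tensorFam_one]

theorem exists_mul_conjTranspose_eq_one [DecidableEq I] [DecidableEq J] (e : J ↪ I) :
    ∃ V : Matrix J I ℂ, V * V.conjTranspose = 1 := by
  refine ⟨(1 : Matrix I I ℂ).submatrix e id, ?_⟩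
  ext a b
  simp [Matrix.mul_apply, Matrix.one_apply, e.injective.eq_iff, eq_comm]

variable [Fintype J]

/-- The state on a larger system obtained from `ρ` by the isometry `Vᴴ`. -/
def QState.embed [DecidableEq J] (ρ : QState J) (V : Matrix J I ℂ)
    (hV : V * V.conjTranspose = 1) : QState I where
  mat := V.conjTranspose * ρ.mat * V
  posSemidef := ρ.posSemidef.conjTranspose_mul_mul_same V
  trace_eq_one := by
    rw [Matrix.trace_mul_comm, ← Matrix.mul_assoc, hV, one_mul, ρ.trace_eq_one]

variable [DecidableEq I] [DecidableEq J]

theorem QState.copies_embed (ρ : QState J) {V : Matrix J I ℂ} (hV : V * V.conjTranspose = 1)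
    (k : ℕ) : (ρ.embed V hV).copies k
      = (ρ.copies k).embed (tensorFam fun _ => V) (tensorFam_mul_conjTranspose_eq_one hV k) := by
  refine QState.ext_mat ?_
  simp only [QState.copies, QState.embed, tensorPow_eq_tensorFam, tensorFam_conjTranspose,
    tensorFam_mul]

/-- The measurement on a smaller system that applies the isometry `Vᴴ` and then measures `M`. -/
noncomputable def POVM.compress {X : Type*} [MeasurableSpace X] (M : POVM I X) (V : Matrix J I ℂ)
    (hV : V * V.conjTranspose = 1) : POVM J X where
  effect := M.effect.mapRange
    { toFun := fun A => V * A * V.conjTranspose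
      map_zero' := by simp
      map_add' := fun A B => by simp only [Matrix.mul_add, Matrix.add_mul] }
    (by
      change Continuous fun A : Matrix I I ℂ => V * A * V.conjTranspose
      fun_prop)
  posSemidef A := by
    rw [VectorMeasure.mapRange_apply]
    exact (M.posSemidef A).mul_mul_conjTranspose_same V
  effect_univ := by
    rw [VectorMeasure.mapRange_apply, M.effect_univ]
    change V * (1 : Matrix I I ℂ) * V.conjTranspose = 1
    rw [Matrix.mul_one, hV]

theorem POVM.law_embed {X : Type*} [MeasurableSpace X] (M : POVM I X) {V : Matrix J I ℂ}
    (hV : V * V.conjTranspose = 1) (ρ : QState J) :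
    M.law (ρ.embed V hV) = (M.compress V hV).law ρ := by
  ext A hA
  rw [M.law_apply _ hA, (M.compress V hV).law_apply _ hA]
  congr 2
  change (M.effect A * (V.conjTranspose * ρ.mat * V)).trace
    = (V * M.effect A * V.conjTranspose * ρ.mat).trace
  rw [← Matrix.mul_assoc, Matrix.trace_mul_comm]
  simp only [Matrix.mul_assoc]

/-- The acceptance probability of a tester on embedded states, expressed by compressed
measurements. -/
theorem FixedTester.acceptProb_embed {d t : ℕ} (T : FixedTester.{u} d t) (ρ : QState J)
    {V : Matrix J (Fin d) ℂ} (hV : V * V.conjTranspose = 1) :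
    T.acceptProb (ρ.embed V hV) = (Measure.pi fun i => ((T.povm i).compress _
      (tensorFam_mul_conjTranspose_eq_one hV (T.size i))).law (ρ.copies (T.size i))).real
        T.accept := by
  simp only [FixedTester.acceptProb, QState.copies_embed, POVM.law_embed]

theorem FixedTester.acceptProb_nonneg {d t : ℕ} (T : FixedTester.{u} d t) (ρ : QState (Fin d)) :
    0 ≤ T.acceptProb ρ := measureReal_nonneg

theorem FixedTester.acceptProb_le_one {d t : ℕ} (T : FixedTester.{u} d t) (ρ : QState (Fin d)) :
    T.acceptProb ρ ≤ 1 := measureReal_le_one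

theorem NonadaptiveTester.integrable_acceptProb {d t : ℕ} (T : NonadaptiveTester.{u, v} d t)
    (ρ : QState (Fin d)) : Integrable (fun ω => (T.tester ω).acceptProb ρ) T.seedLaw := by
  refine (integrable_const (1 : ℝ)).mono' (T.measurable_acceptProb ρ).aestronglyMeasurable ?_
  refine Filter.Eventually.of_forall fun ω => ?_
  rw [Real.norm_of_nonneg (FixedTester.acceptProb_nonneg _ _)]
  exact FixedTester.acceptProb_le_one _ _

theorem NonadaptiveTester.acceptProb_le_one {d t : ℕ} (T : NonadaptiveTester.{u, v} d t)
    (ρ : QState (Fin d)) : T.acceptProb ρ ≤ 1 := by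
  refine (integral_mono (T.integrable_acceptProb ρ) (integrable_const (1 : ℝ))
    fun ω => FixedTester.acceptProb_le_one _ _).trans (le_of_eq ?_)
  simp

end Embedding

/-! ### Random bipartite sign matrices -/

section BipartiteSign

variable {m : ℕ}

theorem trace_fromBlocks_eq {p q : Type} [Fintype p] [Fintype q] (A : Matrix p p ℂ)
    (B : Matrix p q ℂ) (C : Matrix q p ℂ) (D : Matrix q q ℂ) :
    (Matrix.fromBlocks A B C D).trace = A.trace + D.trace := by
  simp [Matrix.trace, Fintype.sum_sum_type]

/-- The matrix units `E_ij` made Hermitian by placing them in the off-diagonal blocks of a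
`2m × 2m` matrix, scaled so that a combination with coefficients `±1` has squared norm `2m`. -/
noncomputable def bipartiteUnit (m : ℕ) (a : Fin m × Fin m) :
    Matrix (Fin m ⊕ Fin m) (Fin m ⊕ Fin m) ℂ :=
  (((Real.sqrt m)⁻¹ : ℝ) : ℂ) •
    Matrix.fromBlocks 0 (Matrix.single a.1 a.2 1) (Matrix.single a.2 a.1 1) 0

theorem isOrthogonalFamily_bipartiteUnit (m : ℕ) :
    IsOrthogonalFamily (bipartiteUnit m) (2 / m) where
  nonneg := by positivity
  isHermitian a := by
    rw [Matrix.IsHermitian, bipartiteUnit, Matrix.conjTranspose_smul,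
      Matrix.fromBlocks_conjTranspose]
    simp
  trace_eq_zero a := by
    rw [bipartiteUnit, Matrix.trace_smul, trace_fromBlocks_eq]; simp
  trace_mul a b := by
    have hm : (((Real.sqrt m)⁻¹ : ℝ) : ℂ) * (((Real.sqrt m)⁻¹ : ℝ) : ℂ) = (m : ℂ)⁻¹ := by
      rw [← Complex.ofReal_mul, ← mul_inv, Real.mul_self_sqrt (Nat.cast_nonneg m)]
      simp
    rw [bipartiteUnit, bipartiteUnit, Matrix.smul_mul, Matrix.mul_smul, smul_smul, hm,
      Matrix.fromBlocks_multiply, Matrix.trace_smul, trace_fromBlocks_eq]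
    obtain ⟨i, j⟩ := a
    obtain ⟨k, l⟩ := b
    by_cases hik : i = k <;> by_cases hjl : j = l
    · subst hik hjl
      simp
      ring
    · simp [hjl, Matrix.single_mul_single_of_ne, hik]
    · simp [hjl, Matrix.single_mul_single_of_ne, hik]
    · simp [hjl, Matrix.single_mul_single_of_ne, hik]

theorem realComb_bipartiteUnit (u : Fin m × Fin m → ℝ) :
    realComb (bipartiteUnit m) u = (((Real.sqrt m)⁻¹ : ℝ) : ℂ) • Matrix.fromBlocks 0
      (Matrix.of fun i j => (u (i, j) : ℂ)) (Matrix.of fun j i => (u (i, j) : ℂ)) 0 := by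
  ext x y
  rw [realComb, Matrix.sum_apply, Fintype.sum_prod_type]
  rcases x with i | j <;> rcases y with i' | j'
  · simp [bipartiteUnit]
  · simp [bipartiteUnit, Matrix.single_apply, ite_and, mul_comm]
  · simp [bipartiteUnit, Matrix.single_apply, ite_and, mul_comm]
  · simp [bipartiteUnit]

/-- The sum of the squared inner products of the rows of a square sign matrix. -/
def rowCorrelation (z : Fin m × Fin m → ℤˣ) : ℝ :=
  ∑ i, ∑ i', (∑ j, signVal (z (i, j)) * signVal (z (i', j))) ^ 2

theorem rowCorrelation_nonneg (z : Fin m × Fin m → ℤˣ) : 0 ≤ rowCorrelation z :=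
  Finset.sum_nonneg fun _ _ => Finset.sum_nonneg fun _ _ => sq_nonneg _

/-- Up to a factor, `rowCorrelation` is the fourth moment of the eigenvalues. -/
theorem trace_fourth_sign (z : Fin m × Fin m → ℤˣ) :
    (realComb (bipartiteUnit m) (fun a => signVal (z a))
      * realComb (bipartiteUnit m) (fun a => signVal (z a))
      * (realComb (bipartiteUnit m) (fun a => signVal (z a))
      * realComb (bipartiteUnit m) fun a => signVal (z a))).trace
      = (2 * rowCorrelation z / m ^ 2 : ℝ) := by
  have hm : (((Real.sqrt m)⁻¹ : ℝ) : ℂ) * (((Real.sqrt m)⁻¹ : ℝ) : ℂ) = (m : ℂ)⁻¹ := by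
    rw [← Complex.ofReal_mul, ← mul_inv, Real.mul_self_sqrt (Nat.cast_nonneg m)]
    simp
  rw [realComb_bipartiteUnit]
  set W : Matrix (Fin m) (Fin m) ℂ := Matrix.of fun i j => (signVal (z (i, j)) : ℂ) with hW
  have hWt : (Matrix.of fun j i => (signVal (z (i, j)) : ℂ)) = W.transpose := rfl
  rw [hWt]
  simp only [Matrix.smul_mul, Matrix.mul_smul, smul_smul, hm, Matrix.fromBlocks_multiply,
    Matrix.trace_smul, trace_fromBlocks_eq, Matrix.zero_mul, Matrix.mul_zero, zero_add,
    add_zero, smul_eq_mul]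
  have h1 : (W.transpose * W * (W.transpose * W)).trace
      = (W * W.transpose * (W * W.transpose)).trace := by
    rw [Matrix.mul_assoc, Matrix.trace_mul_comm]
    simp only [Matrix.mul_assoc]
  have h2 : (W * W.transpose * (W * W.transpose)).trace = (rowCorrelation z : ℂ) := by
    rw [rowCorrelation]
    push_cast
    rw [Matrix.trace]
    refine Finset.sum_congr rfl fun i _ => ?_
    rw [Matrix.diag_apply, Matrix.mul_apply]
    refine Finset.sum_congr rfl fun i' _ => ?_
    simp only [Matrix.mul_apply, Matrix.transpose_apply, hW, Matrix.of_apply]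
    rw [pow_two]
    congr 1
    exact Finset.sum_congr rfl fun j _ => mul_comm _ _
  rw [h1, h2]
  push_cast
  ring

/-- Distinct rows of a random sign matrix are nearly orthogonal on average. -/
theorem expect_rowCorrelation_le (m : ℕ) :
    (𝔼 z : Fin m × Fin m → ℤˣ, rowCorrelation z) ≤ 2 * (m : ℝ) ^ 3 := by
  have hsame : ∀ (i : Fin m) (z : Fin m × Fin m → ℤˣ),
      (∑ j, signVal (z (i, j)) * signVal (z (i, j))) ^ 2 = (m : ℝ) ^ 2 := by
    intro i z
    simp [signVal_mul_self]
  have hdiff : ∀ i i' : Fin m, i ≠ i' → (𝔼 z : Fin m × Fin m → ℤˣ,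
      (∑ j, signVal (z (i, j)) * signVal (z (i', j))) ^ 2) = m := by
    intro i i' hii
    have e : ∀ z : Fin m × Fin m → ℤˣ, (∑ j, signVal (z (i, j)) * signVal (z (i', j))) ^ 2
        = ∑ j, ∑ j', (signVal (z (i, j)) * signVal (z (i', j)))
          * (signVal (z (i, j')) * signVal (z (i', j'))) := fun z => by
      rw [pow_two, Finset.sum_mul_sum]
    simp only [e]
    rw [Finset.expect_sum_comm]
    have h : ∀ j j' : Fin m, (𝔼 z : Fin m × Fin m → ℤˣ,
        (signVal (z (i, j)) * signVal (z (i', j)))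
          * (signVal (z (i, j')) * signVal (z (i', j')))) = if j = j' then 1 else 0 := by
      intro j j'
      split_ifs with hj
      · subst hj
        have : ∀ z : Fin m × Fin m → ℤˣ, (signVal (z (i, j)) * signVal (z (i', j)))
            * (signVal (z (i, j)) * signVal (z (i', j))) = 1 := fun z => by
          rw [mul_mul_mul_comm, signVal_mul_self, signVal_mul_self, one_mul]
        simp only [this]
        simp
      · refine expect_eq_zero_of_flipSign (a := (i, j)) fun z => ?_
        rw [signVal_flipSign_same, flipSign_of_ne (b := (i', j)) (by simp [hii.symm]),
          flipSign_of_ne (b := (i, j')) (by simp [Ne.symm hj]),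
          flipSign_of_ne (b := (i', j')) (by simp [hii.symm])]
        ring
    have h' : ∀ j : Fin m, (𝔼 z : Fin m × Fin m → ℤˣ, ∑ j',
        (signVal (z (i, j)) * signVal (z (i', j)))
          * (signVal (z (i, j')) * signVal (z (i', j')))) = 1 := by
      intro j
      rw [Finset.expect_sum_comm]
      simp [h]
    simp [h']
  simp only [rowCorrelation]
  rw [Finset.expect_sum_comm]
  have hrow : ∀ i : Fin m, (𝔼 z : Fin m × Fin m → ℤˣ,
      ∑ i', (∑ j, signVal (z (i, j)) * signVal (z (i', j))) ^ 2) ≤ 2 * (m : ℝ) ^ 2 := by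
    intro i
    rw [Finset.expect_sum_comm, ← Finset.add_sum_erase _ _ (Finset.mem_univ i)]
    have h1 : ∑ i' ∈ Finset.univ.erase i, (𝔼 z : Fin m × Fin m → ℤˣ,
        (∑ j, signVal (z (i, j)) * signVal (z (i', j))) ^ 2) ≤ m * (m : ℝ) := by
      rw [Finset.sum_congr rfl fun i' hi' => hdiff i i' (Finset.ne_of_mem_erase hi').symm,
        Finset.sum_const, nsmul_eq_mul]
      gcongr
      exact (Finset.card_le_univ _).trans (by simp)
    simp only [hsame]
    rw [Fintype.expect_const]
    linarith
  refine (Finset.sum_le_sum fun i _ => hrow i).trans (le_of_eq ?_)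
  simp
  ring

end BipartiteSign

/-! ### The hard instance -/

section HardInstance

theorem card_sum_fin (m : ℕ) : Fintype.card (Fin m ⊕ Fin m) = 2 * m := by
  simp; ring

/-- The state with density matrix `(1 + a H) / D` for a traceless Hermitian `H` of squared norm
`D` and `a² D ≤ 1`. -/
theorem exists_perturbed_state {J : Type} [Fintype J] [DecidableEq J] [Nonempty J]
    {H : Matrix J J ℂ} (hH : H.IsHermitian) (htr : H.trace = 0)
    (hs : (H * H).trace = Fintype.card J) {a : ℝ} (ha : a ^ 2 * Fintype.card J ≤ 1) :
    ∃ ρ : QState J, ρ.mat = (Fintype.card J : ℂ)⁻¹ • (1 + (a : ℂ) • H) := by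
  have hX : (-((a : ℂ) • H)).IsHermitian := by
    rw [Matrix.IsHermitian, Matrix.conjTranspose_neg, Matrix.conjTranspose_smul, hH.eq]; simp
  have h1 := smul_one_sub_posSemidef hX zero_le_one (by
    rw [neg_mul_neg, Matrix.smul_mul, Matrix.mul_smul, smul_smul, Matrix.trace_smul, hs,
      smul_eq_mul, ← Complex.ofReal_mul, Complex.re_ofReal_mul, Complex.natCast_re]
    linarith)
  rw [sub_neg_eq_add, Complex.ofReal_one, one_smul] at h1
  refine ⟨⟨_, h1.smul (a := (Fintype.card J : ℂ)⁻¹) ?_, ?_⟩, rfl⟩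
  · rw [← Complex.ofReal_natCast, ← Complex.ofReal_inv, Complex.zero_le_real]; positivity
  · rw [Matrix.trace_smul, Matrix.trace_add, Matrix.trace_smul, htr, Matrix.trace_one, smul_zero,
      add_zero, smul_eq_mul, inv_mul_cancel₀ card_ne_zero_complex]

/-- If the rows of the sign matrix `z` are not too correlated, the corresponding perturbation of
the maximally mixed state has trace norm at least `a / 5`. -/
theorem le_traceNorm_perturbation {m d : ℕ} (hm : 1 ≤ m) {V : Matrix (Fin m ⊕ Fin m) (Fin d) ℂ}
    (hV : V * V.conjTranspose = 1) {a : ℝ} (ha : 0 < a) {z : Fin m × Fin m → ℤˣ}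
    (hz : rowCorrelation z ≤ 20 * (m : ℝ) ^ 3) :
    a / 5 ≤ traceNorm (V.conjTranspose * (((a / (2 * m) : ℝ) : ℂ) •
      realComb (bipartiteUnit m) fun b => signVal (z b)) * V) := by
  have hm0 : (0 : ℝ) < m := by exact_mod_cast hm
  set c : ℝ := a / (2 * m) with hc
  set H := realComb (bipartiteUnit m) fun b => signVal (z b) with hH
  have hB := isOrthogonalFamily_bipartiteUnit m
  have hHh : H.conjTranspose = H := hB.realComb_isHermitian _
  have h2 : (H * H).trace = ((2 * m : ℝ) : ℂ) := by
    rw [hB.trace_sign_mul_self (D := 2 * m)]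
    · push_cast; rfl
    · simp; field_simp
  have h4 := trace_fourth_sign z
  rw [← hH] at h4
  set A := V.conjTranspose * ((c : ℂ) • H) * V with hA
  have hVV : ∀ P Q : Matrix (Fin m ⊕ Fin m) (Fin m ⊕ Fin m) ℂ,
      V.conjTranspose * P * V * (V.conjTranspose * Q * V) = V.conjTranspose * (P * Q) * V := by
    intro P Q
    calc _ = V.conjTranspose * P * (V * V.conjTranspose) * Q * V := by
          simp only [Matrix.mul_assoc]
      _ = _ := by rw [hV, Matrix.mul_one]; simp only [Matrix.mul_assoc]
  have hVt : ∀ P : Matrix (Fin m ⊕ Fin m) (Fin m ⊕ Fin m) ℂ,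
      (V.conjTranspose * P * V).trace = P.trace := by
    intro P
    rw [Matrix.trace_mul_comm, ← Matrix.mul_assoc, hV, Matrix.one_mul]
  have hAh : A.conjTranspose = A := by
    rw [hA]
    simp only [Matrix.conjTranspose_mul, Matrix.conjTranspose_smul, hHh,
      Matrix.conjTranspose_conjTranspose, Matrix.mul_assoc]
    simp
  have e2 : (A.conjTranspose * A).trace.re = c ^ 2 * (2 * m) := by
    rw [hAh, hA, hVV, hVt, Matrix.smul_mul, Matrix.mul_smul, smul_smul, Matrix.trace_smul, h2,
      smul_eq_mul, ← Complex.ofReal_mul, ← Complex.ofReal_mul, Complex.ofReal_re, pow_two]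
  have e4 : (A.conjTranspose * A * (A.conjTranspose * A)).trace.re
      = c ^ 4 * (2 * rowCorrelation z / m ^ 2) := by
    rw [hAh, hA, hVV, hVV, hVt]
    simp only [Matrix.smul_mul, Matrix.mul_smul, smul_smul]
    rw [Matrix.trace_smul, h4, smul_eq_mul]
    simp only [← Complex.ofReal_mul, Complex.ofReal_re]
    ring
  -- The scale `r` makes the typical singular value `s` of `A` satisfy `r s = 1 / 5`.
  have hr : 0 < 1 / (5 * c) := by positivity
  have h := le_traceNorm A hr
  rw [e2, e4] at h
  refine le_trans ?_ h
  have hR : rowCorrelation z / (m : ℝ) ^ 2 ≤ 20 * m := by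
    rw [div_le_iff₀ (by positivity)]
    calc _ ≤ 20 * (m : ℝ) ^ 3 := hz
      _ = _ := by ring
  have hc0 : 0 < c := by positivity
  have e : (3 * (1 / (5 * c)) * (c ^ 2 * (2 * m))
      - (1 / (5 * c)) ^ 3 * (c ^ 4 * (2 * rowCorrelation z / m ^ 2))) / 2
      = c * (3 * m / 5 - (rowCorrelation z / m ^ 2) / 125) := by
    field_simp
    ring
  rw [e]
  have e' : a / 5 = c * (2 * m / 5) := by rw [hc]; field_simp
  rw [e']
  exact mul_le_mul_of_nonneg_left (by linarith) hc0.le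

/-- The quantitative lower bound. For `2m ≤ d`, the maximally mixed state of a `2m`-dimensional
subspace cannot be certified with so few copies; `s` stands for `m ^ (3 / 2)`. -/
theorem exists_not_certifies {m d t N : ℕ} (hm : 1 ≤ m) (hd : 2 * m ≤ d) (ht : 1 ≤ t) {a s : ℝ}
    (ha : 0 < a) (hs : 0 ≤ s) (hsm : s ^ 2 = (m : ℝ) ^ 3) (hast : a * s * t ≤ 1 / 10)
    (hN : N * (10 * t * a ^ 2) ≤ s ∨ N * (10 * a ^ 2) ≤ m) :
    ∃ σ : QState (Fin d), ∀ T : NonadaptiveTester.{u, v} d t, T.UsesAtMost N →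
      ¬ T.Certifies (a / 5) σ := by
  have hm1 : (1 : ℝ) ≤ m := by exact_mod_cast hm
  have ht1 : (1 : ℝ) ≤ t := by exact_mod_cast ht
  have hm0 : (0 : ℝ) < m := by linarith
  have ht0 : (0 : ℝ) < t := by linarith
  have hms : (m : ℝ) ≤ s := by
    refine le_of_sq_le_sq ?_ hs
    rw [hsm]; nlinarith [sq_nonneg (m : ℝ)]
  have hs1 : 1 ≤ s := hm1.trans hms
  have has : a * s ≤ 1 / 10 := le_trans (le_mul_of_one_le_right (by positivity) ht1) hast
  have hat : a * t ≤ 1 / 10 := by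
    refine le_trans ?_ hast
    rw [mul_right_comm]
    exact le_mul_of_one_le_right (by positivity) hs1
  have ha1 : a ≤ 1 / 10 := le_trans (le_mul_of_one_le_right ha.le hs1) has
  have : Nonempty (Fin m ⊕ Fin m) := ⟨Sum.inl ⟨0, hm⟩⟩
  have hB := isOrthogonalFamily_bipartiteUnit m
  have hD : (Fintype.card (Fin m ⊕ Fin m) : ℝ) = 2 * m := by rw [card_sum_fin]; push_cast; rfl
  have hcard : (2 / (m : ℝ)) * Fintype.card (Fin m × Fin m) = Fintype.card (Fin m ⊕ Fin m) := by
    rw [hD]; simp; field_simp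
  have ha2 : a ^ 2 * Fintype.card (Fin m ⊕ Fin m) ≤ 1 := by
    rw [hD]
    have h1 : (a * s) ^ 2 ≤ (1 / 10) ^ 2 := pow_le_pow_left₀ (by positivity) has 2
    have h2 : a ^ 2 * m ≤ (a * s) ^ 2 := by
      rw [mul_pow]
      have : (m : ℝ) ≤ s ^ 2 := by nlinarith
      gcongr
    nlinarith
  choose ρ hρ using fun z : Fin m × Fin m → ℤˣ => exists_perturbed_state
    (hB.realComb_isHermitian fun b => signVal (z b)) (hB.trace_realComb _)
    (hB.trace_sign_mul_self hcard z) ha2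
  obtain ⟨V, hV⟩ := exists_mul_conjTranspose_eq_one (I := Fin d)
    (finSumFinEquiv.toEmbedding.trans (Fin.castLEEmb (by omega)) : Fin m ⊕ Fin m ↪ Fin d)
  refine ⟨(QState.maxMixed (Fin m ⊕ Fin m)).embed V hV, fun T hTN hT => ?_⟩
  have hσ : 0.99 ≤ T.acceptProb ((QState.maxMixed (Fin m ⊕ Fin m)).embed V hV) :=
    (hT _).1 rfl
  have hdiff : ∀ z, ((ρ z).embed V hV).mat - ((QState.maxMixed (Fin m ⊕ Fin m)).embed V hV).mat
      = V.conjTranspose * (((a / (2 * m) : ℝ) : ℂ) •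
        realComb (bipartiteUnit m) fun b => signVal (z b)) * V := by
    intro z
    simp only [QState.embed, QState.maxMixed, hρ]
    rw [← Matrix.sub_mul, ← Matrix.mul_sub]
    congr 2
    rw [smul_add, smul_smul]
    have : ((Fintype.card (Fin m ⊕ Fin m) : ℂ))⁻¹ * (a : ℂ) = ((a / (2 * m) : ℝ) : ℂ) := by
      rw [card_sum_fin]; push_cast; ring
    rw [this]
    simp
  -- Markov's inequality: a sign matrix with correlated rows is charged to `rowCorrelation`.
  have hz : ∀ z, T.acceptProb ((ρ z).embed V hV)
      ≤ 0.01 + rowCorrelation z / (20 * (m : ℝ) ^ 3) := by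
    intro z
    have hq : 0 ≤ rowCorrelation z / (20 * (m : ℝ) ^ 3) :=
      div_nonneg (rowCorrelation_nonneg z) (by positivity)
    by_cases hgood : rowCorrelation z ≤ 20 * (m : ℝ) ^ 3
    · have h := (hT ((ρ z).embed V hV)).2 (by
        rw [hdiff]; exact le_traceNorm_perturbation hm hV ha hgood)
      norm_num at h hq ⊢
      linarith
    · have h1 : 1 ≤ rowCorrelation z / (20 * (m : ℝ) ^ 3) := by
        rw [one_le_div (by positivity)]; exact (not_le.mp hgood).le
      have h2 := T.acceptProb_le_one ((ρ z).embed V hV)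
      norm_num at h1 ⊢
      linarith
  have hE : (𝔼 z, T.acceptProb ((ρ z).embed V hV)) ≤ 0.11 := by
    refine (Finset.expect_le_expect fun z _ => hz z).trans ?_
    rw [Finset.expect_add_distrib, ← Finset.expect_div, Fintype.expect_const]
    have : (𝔼 z : Fin m × Fin m → ℤˣ, rowCorrelation z) / (20 * (m : ℝ) ^ 3) ≤ 0.1 := by
      rw [div_le_iff₀ (by positivity)]
      refine (expect_rowCorrelation_le m).trans (le_of_eq ?_)
      norm_num
      ring
    norm_num at this ⊢
    linarith
  set K : ℝ := N * (2 / m) / Fintype.card (Fin m ⊕ Fin m) with hK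
  have hKval : K = N / (m : ℝ) ^ 2 := by rw [hK, hD]; field_simp
  have ht2 : t * a ^ 2 ≤ 1 := by nlinarith
  have hNa : 0 ≤ N * a ^ 2 := by positivity
  -- `S` is whichever bound on the trace of the Gram matrix suits the assumption on `N`.
  obtain ⟨S, hS, hSK, hSN⟩ : ∃ S : ℝ,
      (t * N * (2 / m) ≤ S ∨ Fintype.card (Fin m × Fin m) * K ≤ S) ∧
      a ^ 4 * (K * S) ≤ 1 / 10 ∧ 3 * a ^ 3 * t * N ≤ 1 / 10 := by
    rcases hN with hN | hN
    · refine ⟨t * N * (2 / m), Or.inl le_rfl, ?_, ?_⟩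
      · have e : a ^ 4 * (K * (t * N * (2 / m))) = 2 * t * (N * a ^ 2) ^ 2 / s ^ 2 := by
          rw [hKval, hsm]; field_simp
        rw [e, div_le_iff₀ (by positivity)]
        have h1 : (N * a ^ 2 * (10 * t)) ^ 2 ≤ s ^ 2 :=
          pow_le_pow_left₀ (by positivity) (by linarith) 2
        have h2 : (N * a ^ 2) ^ 2 * t ≤ (N * a ^ 2) ^ 2 * t ^ 2 := by
          gcongr
          nlinarith
        nlinarith
      · have h1 : 3 * a ^ 3 * t * N = 3 / 10 * a * (N * (10 * t * a ^ 2)) := by ring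
        rw [h1]
        calc _ ≤ 3 / 10 * a * s := by gcongr
          _ ≤ 1 / 10 := by linarith
    · refine ⟨Fintype.card (Fin m × Fin m) * K, Or.inr le_rfl, ?_, ?_⟩
      · have e : a ^ 4 * (K * (Fintype.card (Fin m × Fin m) * K)) = (N * a ^ 2) ^ 2 / m ^ 2 := by
          rw [hKval]; simp; field_simp
        rw [e, div_le_iff₀ (by positivity)]
        have h1 : (N * a ^ 2 * 10) ^ 2 ≤ (m : ℝ) ^ 2 :=
          pow_le_pow_left₀ (by positivity) (by linarith) 2
        nlinarith
      · have h1 : 3 * a ^ 3 * t * N = 3 / 10 * (a * t) * (N * (10 * a ^ 2)) := by ring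
        rw [h1]
        calc _ ≤ 3 / 10 * (a * t) * m := by gcongr
          _ ≤ 3 / 10 * (a * t) * s := by gcongr
          _ = 3 / 10 * (a * s * t) := by ring
          _ ≤ 1 / 10 := by linarith
  have hgap : ∀ ω, (T.tester ω).acceptProb ((QState.maxMixed (Fin m ⊕ Fin m)).embed V hV)
      - 𝔼 z, (T.tester ω).acceptProb ((ρ z).embed V hV) ≤ 0.7 := by
    intro ω
    simp only [FixedTester.acceptProb_embed]
    refine (real_sub_expect_law_le _ hB hcard (T.tester ω).one_le_size (T.tester ω).size_le
      (hTN ω) ha (by linarith) ht2 hρ hS (hSK.trans (by norm_num))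
      (T.tester ω).measurableSet_accept).trans ?_
    have h1 : 3 * a ^ 3 * t * N + a ^ 4 * (K * S) ≤ 1 / 5 := by linarith
    refine (div_le_div_of_nonneg_right (Real.exp_le_exp.mpr h1) two_pos.le).trans ?_
    have h2 := Real.exp_bound_div_one_sub_of_interval (x := 1 / 5) (by norm_num) (by norm_num)
    norm_num at h2 ⊢
    linarith
  have hint := integral_mono
    ((T.integrable_acceptProb ((QState.maxMixed (Fin m ⊕ Fin m)).embed V hV)).sub
      (integrable_expect fun z => T.integrable_acceptProb ((ρ z).embed V hV)))
    (integrable_const (0.7 : ℝ)) hgap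
  have e : ∫ ω, ((T.tester ω).acceptProb ((QState.maxMixed (Fin m ⊕ Fin m)).embed V hV)
      - 𝔼 z, (T.tester ω).acceptProb ((ρ z).embed V hV)) ∂T.seedLaw
      = T.acceptProb ((QState.maxMixed (Fin m ⊕ Fin m)).embed V hV)
        - 𝔼 z, T.acceptProb ((ρ z).embed V hV) := by
    rw [integral_sub (T.integrable_acceptProb _)
      (integrable_expect fun z => T.integrable_acceptProb _),
      integral_expect fun z => T.integrable_acceptProb _]
    rfl
  have hint' : T.acceptProb ((QState.maxMixed (Fin m ⊕ Fin m)).embed V hV)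
        - 𝔼 z, T.acceptProb ((ρ z).embed V hV) ≤ 0.7 := by
    rw [← e]
    refine hint.trans (le_of_eq ?_)
    simp
  norm_num at hσ hE hint'
  linarith

end HardInstance

/-! ### The copy complexity -/

/-- As `copyComplexity` is an infimum over natural numbers in `ℕ∞`, a real lower bound is rounded
up first. -/
theorem le_copyComplexity {d t : ℕ} {ε b : ℝ}
    (h : ∀ N : ℕ, (N : ℝ) < b → ∃ σ : QState (Fin d), ∀ T : NonadaptiveTester.{u, v} d t,
      T.UsesAtMost N → ¬ T.Certifies ε σ) :
    ENNReal.ofReal b ≤ (copyComplexity.{u, v} d t ε : ℝ≥0∞) := by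
  have h1 : ((⌈b⌉₊ : ℕ) : ℕ∞) ≤ copyComplexity.{u, v} d t ε := by
    refine le_iInf₂ fun N hN => ?_
    by_contra hlt
    have hlt' : N < ⌈b⌉₊ := by exact_mod_cast not_le.mp hlt
    obtain ⟨σ, hσ⟩ := h N (Nat.lt_ceil.mp hlt')
    obtain ⟨T, hTN, hT⟩ := hN σ
    exact hσ T hTN hT
  calc ENNReal.ofReal b ≤ ENNReal.ofReal (⌈b⌉₊ : ℝ) := ENNReal.ofReal_le_ofReal (Nat.le_ceil b)
    _ = (((⌈b⌉₊ : ℕ) : ℕ∞) : ℝ≥0∞) := by simp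
    _ ≤ _ := ENat.toENNReal_le.mpr h1

theorem rpow_three_halves_sq {x : ℝ} (hx : 0 ≤ x) : (x ^ (3 / 2 : ℝ)) ^ 2 = x ^ 3 := by
  rw [← Real.rpow_natCast (x ^ (3 / 2 : ℝ)) 2, ← Real.rpow_mul hx, ← Real.rpow_natCast]
  norm_num

/-- The lower bound for the subspace dimension `2m`, in terms of `ε`. -/
theorem le_copyComplexity_of_subspace {m d t : ℕ} {ε b : ℝ} (hm : 1 ≤ m) (hd : 2 * m ≤ d)
    (ht : 1 ≤ t) (hε : 0 < ε) (hsmall : ε * (m : ℝ) ^ (3 / 2 : ℝ) * t ≤ 1 / 50)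
    (hb : b ≤ (m : ℝ) ^ (3 / 2 : ℝ) / (250 * t * ε ^ 2) ∨ b ≤ m / (250 * ε ^ 2)) :
    ENNReal.ofReal b ≤ (copyComplexity.{u, v} d t ε : ℝ≥0∞) := by
  have ht0 : (0 : ℝ) < t := by exact_mod_cast ht
  refine le_copyComplexity fun N hN => ?_
  obtain ⟨σ, hσ⟩ := exists_not_certifies.{u, v} (N := N) hm hd ht (a := 5 * ε)
    (s := (m : ℝ) ^ (3 / 2 : ℝ)) (by positivity) (by positivity)
    (rpow_three_halves_sq (Nat.cast_nonneg m)) (by linarith) (by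
      refine hb.imp (fun hb => ?_) fun hb => ?_
      · have := (hN.le.trans hb)
        rw [le_div_iff₀ (by positivity)] at this
        linarith
      · have := (hN.le.trans hb)
        rw [le_div_iff₀ (by positivity)] at this
        linarith)
  refine ⟨σ, fun T hTN => ?_⟩
  have := hσ T hTN
  rwa [mul_div_cancel_left₀ ε (by norm_num : (5 : ℝ) ≠ 0)] at this

theorem div_eight_le_of_sq_le {x y : ℝ} (hy : 0 ≤ y) (h : x ^ 2 ≤ 64 * y ^ 2) : x / 8 ≤ y := by
  have : x ≤ 8 * y := le_of_sq_le_sq (by linarith [show (8 * y) ^ 2 = 64 * y ^ 2 by ring])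
    (by positivity)
  linarith

/-- Passing to a subspace of half the dimension, or rounding, costs a factor `8`. -/
theorem rpow_three_halves_div_eight_le {x y : ℝ} (hx : 0 ≤ x) (h : x ≤ 4 * y) :
    x ^ (3 / 2 : ℝ) / 8 ≤ y ^ (3 / 2 : ℝ) := by
  have hy : 0 ≤ y := by linarith
  refine div_eight_le_of_sq_le (by positivity) ?_
  rw [rpow_three_halves_sq hx, rpow_three_halves_sq hy]
  calc x ^ 3 ≤ (4 * y) ^ 3 := pow_le_pow_left₀ hx h 3
    _ = 64 * y ^ 3 := by ring

theorem mainTheorem6 :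
    (∃ (c₀ c : ℝ) (dStar : ℕ), 0 < c₀ ∧ 0 < c ∧
      ∀ (d t : ℕ) (ε : ℝ), dStar < d → 1 ≤ t → 0 < ε → ε ≤ c₀ / t →
        ENNReal.ofReal
            (c * min ((d : ℝ) ^ (3 / 2 : ℝ) / (t * ε ^ 2)) (1 / ((t : ℝ) ^ 2 * ε ^ 3)))
          ≤ (copyComplexity.{u, v} d t ε : ℝ≥0∞)) ∧
    (∃ (c₀ c : ℝ) (dStar : ℕ), 0 < c₀ ∧ 0 < c ∧
      ∀ (d t : ℕ) (ε : ℝ), dStar < d → 1 ≤ t → 0 < ε → ε ≤ c₀ / ((d : ℝ) ^ (3 / 2 : ℝ) * t) →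
        ENNReal.ofReal
            (c * max ((d : ℝ) ^ (3 / 2 : ℝ) / (t * ε ^ 2)) ((d : ℝ) / ε ^ 2))
          ≤ (copyComplexity.{u, v} d t ε : ℝ≥0∞)) := by
  refine ⟨⟨1 / 50, 1 / 100000, 1, by norm_num, by norm_num, ?_⟩,
    ⟨1 / 50, 1 / 2000, 1, by norm_num, by norm_num, ?_⟩⟩
  · intro d t ε hd ht hε hεt
    have ht0 : (0 : ℝ) < t := by exact_mod_cast ht
    -- The dimension `y` at which `ε y ^ (3 / 2) t = 1 / 50` separates the two regimes.
    set y : ℝ := (1 / (50 * ε * t)) ^ (2 / 3 : ℝ) with hy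
    have hy0 : 0 ≤ y := by positivity
    have hyp : y ^ (3 / 2 : ℝ) = 1 / (50 * ε * t) := by
      rw [hy, ← Real.rpow_mul (by positivity)]
      norm_num
    have hy1 : 1 ≤ y := by
      refine Real.one_le_rpow ?_ (by norm_num)
      rw [one_le_div (by positivity)]
      rw [le_div_iff₀ ht0] at hεt
      linarith
    have hM1 : 1 ≤ ⌊y⌋₊ := (Nat.one_le_floor_iff y).mpr hy1
    set m : ℕ := min ⌊y⌋₊ (d / 2) with hm
    have hm1 : 1 ≤ m := le_min hM1 (by omega)
    have hmy : (m : ℝ) ≤ y :=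
      le_trans (by exact_mod_cast min_le_left _ _) (Nat.floor_le hy0)
    refine le_copyComplexity_of_subspace hm1 (by have := min_le_right ⌊y⌋₊ (d / 2); omega) ht hε
      ?_ (Or.inl ?_)
    · have h1 : (m : ℝ) ^ (3 / 2 : ℝ) ≤ y ^ (3 / 2 : ℝ) :=
        Real.rpow_le_rpow (Nat.cast_nonneg m) hmy (by norm_num)
      calc ε * (m : ℝ) ^ (3 / 2 : ℝ) * t ≤ ε * y ^ (3 / 2 : ℝ) * t := by gcongr
        _ = 1 / 50 := by rw [hyp]; field_simp
    · rcases min_choice ⌊y⌋₊ (d / 2) with h | h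
      · have hle : y ≤ 4 * (m : ℝ) := by
          have h1 := Nat.lt_floor_add_one y
          have h2 : (1 : ℝ) ≤ m := by exact_mod_cast hm1
          have h3 : (m : ℝ) = ⌊y⌋₊ := by rw [hm, h]
          linarith
        have h2 := rpow_three_halves_div_eight_le hy0 hle
        rw [hyp] at h2
        calc 1 / 100000 * min ((d : ℝ) ^ (3 / 2 : ℝ) / (t * ε ^ 2)) (1 / ((t : ℝ) ^ 2 * ε ^ 3))
            ≤ 1 / 100000 * (1 / ((t : ℝ) ^ 2 * ε ^ 3)) := by gcongr; exact min_le_right _ _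
          _ = (1 / (50 * ε * t) / 8) / (250 * t * ε ^ 2) := by field_simp; norm_num
          _ ≤ _ := by gcongr
      · have hle : (d : ℝ) ≤ 4 * (m : ℝ) := by
          have h3 : d ≤ 4 * m := by omega
          exact_mod_cast h3
        have h2 := rpow_three_halves_div_eight_le (Nat.cast_nonneg d) hle
        calc 1 / 100000 * min ((d : ℝ) ^ (3 / 2 : ℝ) / (t * ε ^ 2)) (1 / ((t : ℝ) ^ 2 * ε ^ 3))
            ≤ 1 / 2000 * ((d : ℝ) ^ (3 / 2 : ℝ) / (t * ε ^ 2)) := by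
              gcongr
              · norm_num
              · exact min_le_left _ _
          _ = ((d : ℝ) ^ (3 / 2 : ℝ) / 8) / (250 * t * ε ^ 2) := by field_simp; norm_num
          _ ≤ _ := by gcongr
  · intro d t ε hd ht hε hεt
    have ht0 : (0 : ℝ) < t := by exact_mod_cast ht
    have hd0 : (0 : ℝ) < d := by exact_mod_cast (by omega : 0 < d)
    have hle : (d : ℝ) ≤ 4 * ((d / 2 : ℕ) : ℝ) := by
      have h3 : d ≤ 4 * (d / 2) := by omega
      exact_mod_cast h3
    refine le_copyComplexity_of_subspace (m := d / 2) (by omega) (by omega) ht hε ?_ ?_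
    · have h1 : ((d / 2 : ℕ) : ℝ) ^ (3 / 2 : ℝ) ≤ (d : ℝ) ^ (3 / 2 : ℝ) :=
        Real.rpow_le_rpow (Nat.cast_nonneg _) (by exact_mod_cast Nat.div_le_self d 2)
          (by norm_num)
      rw [le_div_iff₀ (by positivity)] at hεt
      calc ε * ((d / 2 : ℕ) : ℝ) ^ (3 / 2 : ℝ) * t ≤ ε * (d : ℝ) ^ (3 / 2 : ℝ) * t := by gcongr
        _ ≤ 1 / 50 := by linarith
    · rcases max_choice ((d : ℝ) ^ (3 / 2 : ℝ) / (t * ε ^ 2)) ((d : ℝ) / ε ^ 2) with h | h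
      · left
        rw [h]
        have h2 := rpow_three_halves_div_eight_le hd0.le hle
        calc 1 / 2000 * ((d : ℝ) ^ (3 / 2 : ℝ) / (t * ε ^ 2))
            = ((d : ℝ) ^ (3 / 2 : ℝ) / 8) / (250 * t * ε ^ 2) := by field_simp; norm_num
          _ ≤ _ := by gcongr
      · right
        rw [h]
        calc 1 / 2000 * ((d : ℝ) / ε ^ 2) = (d / 8) / (250 * ε ^ 2) := by field_simp; norm_num
          _ ≤ _ := by gcongr; linarith
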